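/- **Definitions.** A *deterministic linear-update counter program* (CP) has counters $c_1,\dots,c_n$ ranging over $\mathbb{Z}$ and instructions numbered $1,\dots,m$ ($m\ge 1$). Each instruction $p<m$ has one of the forms $c_i\leftarrow c_j+c_k$, $c_i\leftarrow c_j-c_k$ (then continue with $p+1$), or $\texttt{if } c_i\ge c_j \texttt{ goto } t$ with $1\le t\le m$ (jump to $t$ if the test succeeds, otherwise continue with $p+1$); operands may coincide. Instruction $m$ is $\texttt{halt}$, which loops to itself. A configuration is a tuple $(p,v_1,\dots,v_n)\in\{1,\dots,m\}\times\mathbb{Z}^n$; a CP comes with an initial configuration in $\{1\}\times\mathbb{N}^n$. The *bounded termination problem* asks, given a CP and $N\in\mathbb{N}$ in binary, whether the $\texttt{halt}$ instruction is reached within $N$ steps. A CP is *simple* if (a) all counter values in all reachable configurations are non-negative; and (b) every test instruction $q$ compares only counters from $\{c_1,c_2\}$, and for each such $q$ there are counters $c_{\bar q_1},c_{\bar q_2}$ such that every reachable configuration $(q,v_1,\dots,v_n)$ satisfies $v_1=a_1v_{\bar q_1}$ and $v_2=a_2v_{\bar q_2}$ for some $a_1,a_2\in\{64,\,64\cdot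 10,\,64\cdot 12\}$, and $|v_1-v_2|\ge v_k$ for all $3\le k\le n$. A *straight-line program* (SLP) of order $n$ is a finite sequence of commands $x\leftarrow\max(T)$, where $x\in\{x_1,\dots,x_n\}$ and $T$ is a non-empty finite list of terms $a_1x_{j_1}+\cdots+a_nx_{j_n}+b$ with $a_i,b\in\{-1,0,1\}$ and $1\le j_i\le n$. A command replaces the value of $x$ by the maximum of the values of the terms in $T$ and leaves the other variables unchanged; the SLP $S$ computes the composition $\llbracket S\rrbracket:\mathbb{Z}^n\to\mathbb{Z}^n$ of its commands, in order. The *powering problem for SLPs* asks, given an SLP $S$ of order $n$, an initial valuation $\nu\in\mathbb{N}^n$, an exponent $M\in\mathbb{N}$ in binary, and two variables $x,y$, whether $\nu'(x)\ge\nu'(y)$ for $\nu'=\llbracket S\rrbracket^M(\nu)$. **Theorem.** The bounded termination problem for simple CPs reduces in polynomial time to the powering problem for SLPs. That is, there is a function $f$, computable in polynomial time by a (multi-stack) Turing machine, from instances of bounded termination to instances of the powering problem such that, for every CP $\mathcal{C}$ that is simple and every $N\in\mathbb{N}$, $\mathcal{C}$ reaches $\texttt{halt}$ within $N$ steps if and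 only if $f(\mathcal{C},N)$ is a positive instance of the powering problem. Instances are given as words over a finite alphabet; the bound $N$, the exponent $M$ and the initial values are written in binary, and programs are listed explicitly. -/

import Mathlib

/-! ### Counter programs -/

/-- Non-halting instructions of a linear-update counter program with `n` counters and `m`
instruction addresses. Counters and addresses are numbered from `0`, and the operands of an
instruction need not be distinct. -/
inductive CPInstr (n m : ℕ) : Type
  /-- `c_i ← c_j + c_k` -/
  | add (i j k : Fin n)
  /-- `c_i ← c_j - c_k` -/
  | sub (i j k : Fin n)
  /-- `if c_i ≥ c_j goto t` -/
  | test (i j : Fin n) (t : Fin m)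

/-- A deterministic linear-update counter program with its initial counter values. It has
`len + 1` instructions: `code p` at the addresses `p < len`, and `halt` at the address `len`. -/
structure CounterProgram : Type where
  /-- number of counters -/
  n : ℕ
  /-- number of instructions other than the final `halt` -/
  len : ℕ
  /-- the instructions before the final `halt` -/
  code : Fin len → CPInstr n (len + 1)
  /-- initial (non-negative) counter values -/
  init : Fin n → ℕ

namespace CounterProgram

/-- A configuration: the address of the current instruction and the integer counter values. -/
structure Config (C : CounterProgram) : Type where
  pc : Fin (C.len + 1)
  val : Fin C.n → ℤ

/-- The initial configuration: first instruction, initial counter values. -/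
def initial (C : CounterProgram) : C.Config :=
  ⟨0, fun i => (C.init i : ℤ)⟩

/-- The effect of executing the instruction `ins`, where `next` is the following address. -/
def exec (C : CounterProgram) (next : Fin (C.len + 1)) (v : Fin C.n → ℤ) :
    CPInstr C.n (C.len + 1) → C.Config
  | .add i j k => ⟨next, Function.update v i (v j + v k)⟩
  | .sub i j k => ⟨next, Function.update v i (v j - v k)⟩
  | .test i j t => if v i ≥ v j then ⟨t, v⟩ else ⟨next, v⟩

/-- One step; the `halt` instruction loops to itself. -/
def step (C : CounterProgram) (c : C.Config) : C.Config :=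
  if h : c.pc.val < C.len then
    C.exec ⟨c.pc.val + 1, Nat.succ_lt_succ h⟩ c.val (C.code ⟨c.pc.val, h⟩)
  else c

/-- The configuration after `t` steps from the initial configuration. -/
def run (C : CounterProgram) (t : ℕ) : C.Config :=
  C.step^[t] C.initial

/-- Reachability from the initial configuration, in any number of steps. -/
def Reachable (C : CounterProgram) (c : C.Config) : Prop :=
  ∃ t : ℕ, C.run t = c

/-- The `halt` instruction is reached within `N` steps. -/
def HaltsWithin (C : CounterProgram) (N : ℕ) : Prop :=
  ∃ t ≤ N, (C.run t).pc = Fin.last C.len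

/-- Simple counter programs. All reachable counter values are non-negative; every test
instruction uses only the first two counters `c₁`, `c₂`, and there are counters `d₁`, `d₂` such
that whenever the test is about to be executed, the values of `c₁` and `c₂` are scaled-up
versions of those of `d₁` and `d₂`, and differ by at least the value of every counter other than
`c₁`, `c₂`. -/
def IsSimple (C : CounterProgram) : Prop :=
  (∀ c, C.Reachable c → ∀ i, 0 ≤ c.val i) ∧
  ∀ (q : Fin C.len) (i j : Fin C.n) (r : Fin (C.len + 1)), C.code q = .test i j r →
    ∃ c₁ c₂ d₁ d₂ : Fin C.n,
      c₁.val = 0 ∧ c₂.val = 1 ∧ (i = c₁ ∨ i = c₂) ∧ (j = c₁ ∨ j = c₂) ∧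
      ∀ c, C.Reachable c → c.pc.val = q.val →
        (∃ a₁ ∈ ({64, 64 * 10, 64 * 12} : Set ℤ), c.val c₁ = a₁ * c.val d₁) ∧
        (∃ a₂ ∈ ({64, 64 * 10, 64 * 12} : Set ℤ), c.val c₂ = a₂ * c.val d₂) ∧
        ∀ k : Fin C.n, 2 ≤ k.val → c.val k ≤ |c.val c₁ - c.val c₂|

end CounterProgram

/-- An instance of bounded termination: a counter program and a bound on the number of steps. -/
structure TerminationInstance : Type where
  program : CounterProgram
  bound : ℕ

/-! ### Straight-line programs over `max`, `+`, `-` -/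

/-- The term `a_1 x_{j_1} + ⋯ + a_n x_{j_n} + b` with `a_i, b ∈ {-1, 0, 1}`. -/
structure SLPTerm (n : ℕ) : Type where
  coeff : Fin n → SignType
  idx : Fin n → Fin n
  const : SignType

/-- The value of a term under a valuation. -/
def SLPTerm.eval {n : ℕ} (t : SLPTerm n) (v : Fin n → ℤ) : ℤ :=
  (∑ i, (t.coeff i : ℤ) * v (t.idx i)) + (t.const : ℤ)

/-- The command `x ← max(T)`, with `T` the non-empty list `first :: rest` of terms. -/
structure SLPCommand (n : ℕ) : Type where
  target : Fin n
  first : SLPTerm n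
  rest : List (SLPTerm n)

/-- The function computed by a command. -/
def SLPCommand.sem {n : ℕ} (c : SLPCommand n) (v : Fin n → ℤ) : Fin n → ℤ :=
  Function.update v c.target
    (c.rest.foldl (fun m t => max m (t.eval v)) (c.first.eval v))

/-- A straight-line program of order `n`: a sequence of commands. -/
abbrev SLP (n : ℕ) : Type := List (SLPCommand n)

/-- The function computed by a straight-line program; the head of the list is executed first. -/
def SLP.sem {n : ℕ} (S : SLP n) (v : Fin n → ℤ) : Fin n → ℤ :=
  S.foldl (fun w c => c.sem w) v

/-- An instance of the powering problem: a straight-line program, an initial valuation with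
natural entries, an exponent, and two variables. -/
structure PoweringInstance : Type where
  n : ℕ
  prog : SLP n
  init : Fin n → ℕ
  exponent : ℕ
  x : Fin n
  y : Fin n

/-- The question of the powering problem: `ν'(x) ≥ ν'(y)` for `ν' = ⟦S⟧^m(ν)`. -/
def PoweringInstance.IsPositive (P : PoweringInstance) : Prop :=
  (P.prog.sem)^[P.exponent] (fun i => (P.init i : ℤ)) P.x ≥
    (P.prog.sem)^[P.exponent] (fun i => (P.init i : ℤ)) P.y

/-! ### Encodings of the instances as words

The bound, the exponent and the initial values are written in binary. Counter, variable and
instruction numbers are written in unary; each is at most the number of entries listed in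
the same instance, so that this is polynomially equivalent to writing them in binary. -/

/-- The alphabet. -/
inductive CodeSym : Type
  | tick
  | sep
  | bit (b : Bool)
  | opAdd
  | opSub
  | opTest
  | sign (s : SignType)
  deriving DecidableEq, Fintype

/-- Unary code of a number. -/
def encUnary (k : ℕ) : List CodeSym :=
  List.replicate k CodeSym.tick ++ [CodeSym.sep]

/-- Binary code of a number, least significant bit first. -/
def encBinary (k : ℕ) : List CodeSym :=
  (Computability.encodeNat k).map CodeSym.bit ++ [CodeSym.sep]

/-- Code of a tuple of known length. -/
def encTuple {α : Type} (enc : α → List CodeSym) {n : ℕ} (f : Fin n → α) : List CodeSym :=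
  (List.ofFn fun i => enc (f i)).flatten

/-- Code of a list. -/
def encList {α : Type} (enc : α → List CodeSym) : List α → List CodeSym
  | [] => [CodeSym.sep]
  | a :: l => CodeSym.tick :: (enc a ++ encList enc l)

/-- Code of a counter, a variable or an instruction address. -/
def encFin {n : ℕ} (i : Fin n) : List CodeSym := encUnary i.val

/-- Code of an instruction. -/
def CPInstr.encode {n m : ℕ} : CPInstr n m → List CodeSym
  | .add i j k => CodeSym.opAdd :: (encFin i ++ (encFin j ++ encFin k))
  | .sub i j k => CodeSym.opSub :: (encFin i ++ (encFin j ++ encFin k))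
  | .test i j t => CodeSym.opTest :: (encFin i ++ (encFin j ++ encFin t))

/-- Code of an instance of bounded termination. -/
def TerminationInstance.encode (I : TerminationInstance) : List CodeSym :=
  encUnary I.program.n ++ (encUnary I.program.len ++ (encTuple encBinary I.program.init ++
    (encTuple CPInstr.encode I.program.code ++ encBinary I.bound)))

/-- Code of a term: the coefficients, the indices, the constant. -/
def SLPTerm.encode {n : ℕ} (t : SLPTerm n) : List CodeSym :=
  encTuple (fun s => [CodeSym.sign s]) t.coeff ++ (encTuple encFin t.idx ++ [CodeSym.sign t.const])

/-- Code of a command. -/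
def SLPCommand.encode {n : ℕ} (c : SLPCommand n) : List CodeSym :=
  encFin c.target ++ (c.first.encode ++ encList SLPTerm.encode c.rest)

/-- Code of an instance of the powering problem. -/
def PoweringInstance.encode (P : PoweringInstance) : List CodeSym :=
  encUnary P.n ++ (encTuple encBinary P.init ++ (encList SLPCommand.encode P.prog ++
    (encBinary P.exponent ++ (encFin P.x ++ encFin P.y))))

/-! The codes determine the instances. -/

theorem encUnary_inj {a b : ℕ} {s t : List CodeSym} (h : encUnary a ++ s = encUnary b ++ t) :
    a = b ∧ s = t := by
  induction a generalizing b with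
  | zero => cases b <;> simp_all [encUnary, List.replicate_succ]
  | succ a ih =>
    cases b with
    | zero => simp [encUnary, List.replicate_succ] at h
    | succ b =>
      have := @ih b (by simpa [encUnary, List.replicate_succ] using h)
      exact ⟨by rw [this.1], this.2⟩

theorem encBits_inj {a b : List Bool} {s t : List CodeSym}
    (h : a.map CodeSym.bit ++ CodeSym.sep :: s = b.map CodeSym.bit ++ CodeSym.sep :: t) : a = b ∧ s = t := by
  induction a generalizing b with
  | nil => cases b <;> simp_all
  | cons x a ih =>
    cases b with
    | nil => simp at h
    | cons y b =>
      simp only [List.map_cons, List.cons_append, List.cons.injEq, CodeSym.bit.injEq] at h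
      have := ih h.2
      exact ⟨by rw [h.1, this.1], this.2⟩

theorem encBinary_inj {a b : ℕ} {s t : List CodeSym} (h : encBinary a ++ s = encBinary b ++ t) :
    a = b ∧ s = t := by
  have := @encBits_inj (Computability.encodeNat a) (Computability.encodeNat b) s t
    (by simpa [encBinary] using h)
  exact ⟨by rw [← Computability.decode_encodeNat a, this.1, Computability.decode_encodeNat],
    this.2⟩

theorem encTuple_inj {α : Type} {enc : α → List CodeSym}
    (henc : ∀ a b s t, enc a ++ s = enc b ++ t → a = b ∧ s = t) {n : ℕ} {f g : Fin n → α}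
    {s t : List CodeSym} (h : encTuple enc f ++ s = encTuple enc g ++ t) : f = g ∧ s = t := by
  induction n with
  | zero => exact ⟨funext fun i => i.elim0, by simpa [encTuple] using h⟩
  | succ n ih =>
    simp only [encTuple, List.ofFn_succ, List.flatten_cons, List.append_assoc] at h
    obtain ⟨h0, h1⟩ := henc _ _ _ _ h
    obtain ⟨h2, h3⟩ := @ih (fun i => f i.succ) (fun i => g i.succ) h1
    refine ⟨funext fun i => ?_, h3⟩
    induction i using Fin.cases with
    | zero => exact h0
    | succ i => exact congrFun h2 i

theorem encList_inj {α : Type} {enc : α → List CodeSym}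
    (henc : ∀ a b s t, enc a ++ s = enc b ++ t → a = b ∧ s = t) {l k : List α}
    {s t : List CodeSym} (h : encList enc l ++ s = encList enc k ++ t) : l = k ∧ s = t := by
  induction l generalizing k with
  | nil => cases k <;> simp_all [encList]
  | cons a l ih =>
    cases k with
    | nil => simp [encList] at h
    | cons b k =>
      simp only [encList, List.cons_append, List.append_assoc, List.cons.injEq, true_and] at h
      obtain ⟨h0, h1⟩ := henc _ _ _ _ h
      obtain ⟨h2, h3⟩ := ih h1
      exact ⟨by rw [h0, h2], h3⟩

theorem encFin_inj {n : ℕ} (i j : Fin n) (s t : List CodeSym) (h : encFin i ++ s = encFin j ++ t) :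
    i = j ∧ s = t :=
  ⟨Fin.ext (encUnary_inj h).1, (encUnary_inj h).2⟩

theorem CPInstr.encode_inj {n m : ℕ} (a b : CPInstr n m) (s t : List CodeSym)
    (h : a.encode ++ s = b.encode ++ t) : a = b ∧ s = t := by
  cases a <;> cases b <;>
    simp only [CPInstr.encode, List.cons_append, List.append_assoc, List.cons.injEq, true_and,
      reduceCtorEq, false_and] at h
  all_goals
    obtain ⟨h0, h⟩ := encFin_inj _ _ _ _ h
    obtain ⟨h1, h⟩ := encFin_inj _ _ _ _ h
    obtain ⟨h2, h⟩ := encFin_inj _ _ _ _ h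
    exact ⟨by rw [h0, h1, h2], h⟩

theorem TerminationInstance.encode_injective : Function.Injective TerminationInstance.encode := by
  rintro ⟨⟨n, l, c, v⟩, N⟩ ⟨⟨n', l', c', v'⟩, N'⟩ h
  obtain ⟨h0, h⟩ := encUnary_inj h
  obtain ⟨h1, h⟩ := encUnary_inj h
  dsimp only at h0 h1
  subst h0 h1
  obtain ⟨h2, h⟩ := encTuple_inj (fun _ _ _ _ => encBinary_inj) h
  obtain ⟨h3, h⟩ := encTuple_inj CPInstr.encode_inj h
  obtain ⟨h4, -⟩ := @encBinary_inj N N' [] [] (by simpa using h)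
  dsimp only at h2 h3
  rw [h2, h3, h4]

theorem SLPTerm.encode_inj {n : ℕ} (a b : SLPTerm n) (s t : List CodeSym)
    (h : a.encode ++ s = b.encode ++ t) : a = b ∧ s = t := by
  obtain ⟨a, i, e⟩ := a
  obtain ⟨a', i', e'⟩ := b
  simp only [SLPTerm.encode, List.append_assoc] at h
  obtain ⟨h0, h⟩ := encTuple_inj (fun _ _ _ _ h => by simpa using h) h
  obtain ⟨h1, h⟩ := encTuple_inj encFin_inj h
  simp only [List.cons_append, List.nil_append, List.cons.injEq, CodeSym.sign.injEq] at h
  exact ⟨by rw [h0, h1, h.1], h.2⟩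

theorem SLPCommand.encode_inj {n : ℕ} (a b : SLPCommand n) (s t : List CodeSym)
    (h : a.encode ++ s = b.encode ++ t) : a = b ∧ s = t := by
  obtain ⟨x, f, r⟩ := a
  obtain ⟨x', f', r'⟩ := b
  simp only [SLPCommand.encode, List.append_assoc] at h
  obtain ⟨h0, h⟩ := encFin_inj _ _ _ _ h
  obtain ⟨h1, h⟩ := SLPTerm.encode_inj _ _ _ _ h
  obtain ⟨h2, h⟩ := encList_inj SLPTerm.encode_inj h
  exact ⟨by rw [h0, h1, h2], h⟩

theorem PoweringInstance.encode_injective : Function.Injective PoweringInstance.encode := by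
  rintro ⟨n, S, v, N, x, y⟩ ⟨n', S', v', N', x', y'⟩ h
  obtain ⟨h0, h⟩ := encUnary_inj h
  dsimp only at h0
  subst h0
  obtain ⟨h1, h⟩ := encTuple_inj (fun _ _ _ _ => encBinary_inj) h
  obtain ⟨h2, h⟩ := encList_inj SLPCommand.encode_inj h
  obtain ⟨h3, h⟩ := encBinary_inj h
  obtain ⟨h4, h⟩ := encFin_inj _ _ _ _ h
  obtain ⟨h5, -⟩ := encFin_inj y y' [] [] (by simpa using h)
  dsimp only at h1 h2 h3 h4
  rw [h1, h2, h3, h4, h5]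

/-! The straight-line program keeps one cell for every pair of an instruction address and a counter,
plus an indicator cell for every address. Only the cells of the current address carry values; all
others are zero. A pass treats the addresses before `halt` in order. The block of an inactive
address has no effect on this representation, since it computes with zeros (`SimVar.Rep.instr_ne`).
The block of the active address performs one step by moving a row of cells (`SimVar.Rep.instr_eq`).

A conditional jump has to be made with `max` alone. For a test `v i ≥ v j`, put `gap = 1024 * max (v
j - v i) 0` and split every cell `x` of the row into `min x gap`, sent to the next address, and `x -
min x gap`, sent to the jump target. If the test succeeds then `gap = 0`, and non-negativity sends
everything to the target. If it fails, simplicity makes `gap` at least as large as every counter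
(`CounterProgram.IsSimple.le_of_test`), so everything goes to the next address.

Forward moves let one pass simulate several steps, so the number `m` of steps after `N` passes is
not determined in advance. But every pass begun before halting performs at least one step, and
nothing moves after halting. Hence either the run is at its first halting time `m`, or it has not
halted and `m ≥ N` (`iterate_pass`). The variable `excess = 1 - N + m` settles both cases: the
indicator of `halt` is at least `excess` iff halting occurs within `N` steps (`haltsWithin_iff`).
The exponent is therefore the bound itself.

For polynomial time, the output word is produced by a loop language on unary registers. Its size
measure never increases (`TProg.size_eval`), so every loop count is linear in the input length, and
fixed nesting gives polynomial bounds on time and output. Programs compile to multi-stack machines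
(`TProg.sim`, `TProg.polyTime`), and `TProg.eval_reduction` verifies the program for the reduction.
-/

/-! ### Transducer programs

A small loop language over unary registers which reads a word from left to right and writes a
word from left to right. Every loop is bounded by the value of a register, and registers only
grow by reading input, so every program runs in polynomial time on a multi-stack machine. -/

/-- State of a transducer program: remaining input, register values, output so far. -/
@[ext]
structure TState (R : Type) : Type where
  inp : List CodeSym
  reg : R → ℕ
  out : List CodeSym

/-- Transducer programs with registers in `R`. -/
inductive TProg (R : Type) : Type
  /-- write a word -/
  | emit (w : List CodeSym)
  /-- reset a register -/
  | clear (r : R)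
  /-- read input symbols up to the first one that is not `tick`, adding the number of ticks to
  `r` and the number of symbols to `r'` -/
  | read (r r' : R)
  /-- copy the input up to the first separator to the output -/
  | copy
  | seq (p q : TProg R)
  /-- run `p` as many times as the value of `r`; meanwhile `r` counts down and `i` counts up -/
  | loop (r i : R) (p : TProg R)
  /-- read a symbol and branch on it -/
  | branch (p q r : TProg R)

/-! ### Elementary operations on states and the size measure -/

namespace TState

variable {R : Type} [DecidableEq R]

/-- Assignment to a register. -/
def set (s : TState R) (r : R) (m : ℕ) : TState R :=
  { s with reg := Function.update s.reg r m }

/-- Write a word. -/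
def write (s : TState R) (w : List CodeSym) : TState R :=
  { s with out := s.out ++ w }

/-- The effect of `TProg.read`. -/
def readTicks (r r' : R) : List CodeSym → TState R → TState R
  | [], s => { s with inp := [] }
  | .tick :: l, s => readTicks r r' l
      (({ s with inp := l }.set r (s.reg r + 1)).set r' ((s.set r (s.reg r + 1)).reg r' + 1))
  | _ :: l, s => { s with inp := l }.set r' (s.reg r' + 1)

/-- The effect of `TProg.copy`. -/
def copySep : List CodeSym → TState R → TState R
  | [], s => { s with inp := [] }
  | a :: l, s =>
    if a = .sep then { s with inp := l }.write [a] else copySep l ({ s with inp := l }.write [a])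

/-- A bound on the values of all registers in the future. -/
def size [Fintype R] (s : TState R) : ℕ := ∑ r, s.reg r + 2 * s.inp.length

theorem sum_update_add {α : Type*} [Fintype α] [DecidableEq α] (f : α → ℕ) (a : α) (m : ℕ) :
    ∑ b, Function.update f a m b + f a = ∑ b, f b + m := by
  rw [Finset.sum_update_of_mem (Finset.mem_univ a), ← Finset.sum_sdiff
    (Finset.subset_univ {a}) (f := f), Finset.sum_singleton]
  omega

theorem size_set [Fintype R] (s : TState R) (r : R) (m : ℕ) :
    (s.set r m).size + s.reg r = s.size + m := by
  have := sum_update_add s.reg r m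
  simp only [size, set]
  omega

theorem reg_le_size [Fintype R] (s : TState R) (r : R) : s.reg r ≤ s.size :=
  (Finset.single_le_sum (f := s.reg) (fun _ _ => Nat.zero_le _) (Finset.mem_univ r)).trans
    (Nat.le_add_right _ _)

theorem size_inp_cons [Fintype R] (s : TState R) (a : CodeSym) (l : List CodeSym)
    (h : s.inp = a :: l) : ({ s with inp := l } : TState R).size + 2 = s.size := by
  simp only [size, h, List.length_cons]
  omega

/-- An input symbol has weight 2, which pays for the at most two register increments that reading it
causes. -/
theorem size_readTicks [Fintype R] (r r' : R) (l : List CodeSym) (s : TState R)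
    (h : s.inp = l) : (readTicks r r' l s).size ≤ s.size := by
  induction l generalizing s with
  | nil => rw [readTicks, ← h]
  | cons a l ih =>
    have h2 := size_inp_cons s a l h
    by_cases ha : a = .tick
    · subst ha
      rw [readTicks]
      refine (ih _ rfl).trans ?_
      have h3 := size_set { s with inp := l } r (s.reg r + 1)
      have h4 := size_set ({ s with inp := l }.set r (s.reg r + 1)) r'
        ((s.set r (s.reg r + 1)).reg r' + 1)
      simp only [set] at h3 h4 ⊢
      omega
    · have h3 := size_set { s with inp := l } r' (s.reg r' + 1)
      simp only at h3
      rw [readTicks]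
      · omega
      · exact ha

theorem size_copySep [Fintype R] (l : List CodeSym) (s : TState R)
    (h : s.inp = l) : (copySep l s).size ≤ s.size := by
  induction l generalizing s with
  | nil => rw [copySep, ← h]
  | cons a l ih =>
    have h2 := size_inp_cons s a l h
    have h3 : ({ s with inp := l }.write [a]).size = ({ s with inp := l } : TState R).size := rfl
    rw [copySep]
    split_ifs
    · omega
    · have := ih ({ s with inp := l }.write [a]) rfl
      omega

end TState

namespace TProg

variable {R : Type} [DecidableEq R]

/-- The effect of a program. -/
def eval : TProg R → TState R → TState R
  | emit w, s => s.write w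
  | clear r, s => s.set r 0
  | read r r', s => s.readTicks r r' s.inp
  | copy, s => s.copySep s.inp
  | seq p q, s => q.eval (p.eval s)
  | loop r i p, s =>
    let body := fun u : TState R =>
      let u' := p.eval (u.set r (u.reg r - 1))
      u'.set i (u'.reg i + 1)
    let u := body^[s.reg r] s
    (u.set r (u.reg r + u.reg i)).set i 0
  | branch p q r, s =>
    let u := { s with inp := s.inp.tail }
    if s.inp.head? = some .opAdd then p.eval u
    else if s.inp.head? = some .opSub then q.eval u else r.eval u

/-- The register occurs in the program. -/
def Uses (a : R) : TProg R → Prop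
  | emit _ | copy => False
  | clear r => a = r
  | read r r' => a = r ∨ a = r'
  | seq p q => p.Uses a ∨ q.Uses a
  | loop r i p => a = r ∨ a = i ∨ p.Uses a
  | branch p q r => p.Uses a ∨ q.Uses a ∨ r.Uses a

/-- The loop registers are used properly. -/
def WF : TProg R → Prop
  | emit _ | copy | clear _ | read _ _ => True
  | seq p q => p.WF ∧ q.WF
  | loop r i p => r ≠ i ∧ ¬ p.Uses r ∧ p.WF
  | branch p q r => p.WF ∧ q.WF ∧ r.WF

theorem reg_readTicks (a r r' : R) (hr : a ≠ r) (hr' : a ≠ r') (l : List CodeSym)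
    (s : TState R) : (s.readTicks r r' l).reg a = s.reg a := by
  induction l generalizing s with
  | nil => rfl
  | cons b l ih =>
    by_cases hb : b = .tick
    · subst hb
      rw [TState.readTicks, ih]
      simp [TState.set, hr, hr']
    · rw [TState.readTicks]
      · simp [TState.set, hr']
      · exact hb

theorem reg_copySep (a : R) (l : List CodeSym) (s : TState R) :
    (s.copySep l).reg a = s.reg a := by
  induction l generalizing s with
  | nil => rfl
  | cons b l ih =>
    rw [TState.copySep]
    split_ifs
    · rfl
    · rw [ih]; rfl

/-- A frame property. It is needed for the counting register of a loop, which the body must leave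
alone. -/
theorem reg_eval (p : TProg R) (a : R) (h : ¬ p.Uses a) (s : TState R) :
    (p.eval s).reg a = s.reg a := by
  induction p generalizing s with
  | emit w => rfl
  | clear r => simp only [Uses] at h; simp [eval, TState.set, h]
  | read r r' =>
    simp only [Uses, not_or] at h
    exact reg_readTicks a r r' h.1 h.2 _ _
  | copy => exact reg_copySep a _ _
  | seq p q hp hq =>
    simp only [Uses, not_or] at h
    rw [eval, hq h.2, hp h.1]
  | loop r i p ih =>
    simp only [Uses, not_or] at h
    simp only [eval, TState.set, Function.update_of_ne h.1, Function.update_of_ne h.2.1]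
    generalize s.reg r = m
    induction m generalizing s with
    | zero => rfl
    | succ m ihm =>
      rw [Function.iterate_succ_apply, ihm]
      simp only [Function.update_of_ne h.2.1]
      rw [ih h.2.2]
      simp only [Function.update_of_ne h.1]
  | branch p q r hp hq hr =>
    simp only [Uses, not_or] at h
    simp only [eval]
    split_ifs
    · rw [hp h.1]
    · rw [hq h.2.1]
    · rw [hr h.2.2]

/-- The decrement of `r` pays for the increment of `i`. Positivity is required because subtraction
is truncated. -/
theorem size_loop_body [Fintype R] {r i : R} {p : TProg R}
    (ih : ∀ s : TState R, (p.eval s).size ≤ s.size) (u : TState R) (hr : 0 < u.reg r) :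
    ((p.eval (u.set r (u.reg r - 1))).set i ((p.eval (u.set r (u.reg r - 1))).reg i + 1)).size
      ≤ u.size := by
  have h1 := ih (u.set r (u.reg r - 1))
  have h2 := TState.size_set u r (u.reg r - 1)
  have h3 := TState.size_set (p.eval (u.set r (u.reg r - 1))) i
    ((p.eval (u.set r (u.reg r - 1))).reg i + 1)
  omega

/-- This reconciles the two views of a loop: the iteration count fixed at entry, and the machine's
test for an empty stack before each round. -/
theorem reg_loop_body {r i : R} {p : TProg R} (hri : r ≠ i) (hp : ¬ p.Uses r) (u : TState R) :
    ((p.eval (u.set r (u.reg r - 1))).set i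
      ((p.eval (u.set r (u.reg r - 1))).reg i + 1)).reg r = u.reg r - 1 := by
  simp only [TState.set, Function.update_of_ne hri]
  rw [reg_eval p r hp]
  simp

/-- The size at the start thus bounds every later register value, hence every later loop count. At
the end of a loop the content of `i` is transferred back to `r`, which keeps the sum. -/
theorem size_eval [Fintype R] (p : TProg R) (h : p.WF) (s : TState R) :
    (p.eval s).size ≤ s.size := by
  induction p generalizing s with
  | emit w => exact le_rfl
  | clear r => have := TState.size_set s r 0; simp only [eval]; omega
  | read r r' => exact TState.size_readTicks r r' _ _ rfl
  | copy => exact TState.size_copySep _ _ rfl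
  | seq p q hp hq => exact (hq h.2 _).trans (hp h.1 _)
  | loop r i p ih =>
    have key : ∀ m (u : TState R), u.reg r = m →
        ((fun u : TState R => (p.eval (u.set r (u.reg r - 1))).set i
          ((p.eval (u.set r (u.reg r - 1))).reg i + 1))^[m] u).size ≤ u.size := by
      intro m
      induction m with
      | zero => intro u _; exact le_rfl
      | succ m ihm =>
        intro u hu
        rw [Function.iterate_succ_apply]
        refine (ihm _ ?_).trans (size_loop_body (ih h.2.2) u (by omega))
        rw [reg_loop_body h.1 h.2.1, hu]; rfl
    have h1 := key _ s rfl
    simp only [eval]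
    generalize (_)^[s.reg r] s = u at h1 ⊢
    have h2 := TState.size_set u r (u.reg r + u.reg i)
    have h3 := TState.size_set (u.set r (u.reg r + u.reg i)) i 0
    have h4 : (u.set r (u.reg r + u.reg i)).reg i = u.reg i := by
      simp [TState.set, h.1.symm]
    omega
  | branch p q r hp hq hr =>
    have h1 : ({ s with inp := s.inp.tail } : TState R).size ≤ s.size := by
      simp only [TState.size, List.length_tail]; omega
    simp only [eval]
    split_ifs
    · exact (hp h.1 _).trans h1
    · exact (hq h.2.1 _).trans h1
    · exact (hr h.2.2 _).trans h1

end TProg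

/-! ### Compilation to multi-stack machines -/

open Turing

/-- The stacks of the machine: input, accumulated output (reversed), output, registers. -/
inductive TStack (R : Type) : Type
  | inp
  | acc
  | res
  | reg (r : R)
  deriving DecidableEq, Fintype

/-- `Steps M T c c'`: the machine gets from `c` to `c'` in at most `T` steps. -/
def Steps {K Λ σ : Type} [DecidableEq K] {Γ : K → Type} (M : Λ → TM2.Stmt Γ Λ σ) (T : ℕ)
    (c c' : TM2.Cfg Γ Λ σ) : Prop :=
  ∃ t ≤ T, (flip bind (TM2.step M))^[t] (some c) = some c'

namespace Steps

variable {K Λ σ : Type} [DecidableEq K] {Γ : K → Type} {M : Λ → TM2.Stmt Γ Λ σ}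
  {c c' c'' : TM2.Cfg Γ Λ σ} {T T' : ℕ}

theorem trans (h : Steps M T c c') (h' : Steps M T' c' c'') : Steps M (T + T') c c'' := by
  obtain ⟨t, ht, h⟩ := h
  obtain ⟨t', ht', h'⟩ := h'
  refine ⟨t' + t, by omega, ?_⟩
  rw [Function.iterate_add_apply, h, h']

theorem mono (h : Steps M T c c') (hT : T ≤ T') : Steps M T' c c' :=
  let ⟨t, ht, h⟩ := h
  ⟨t, ht.trans hT, h⟩

theorem single {l : Λ} {v : σ} {S : ∀ k, List (Γ k)} (h : TM2.stepAux (M l) v S = c') :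
    Steps M 1 ⟨some l, v, S⟩ c' :=
  ⟨1, le_rfl, by rw [← h]; rfl⟩

theorem head {l : Λ} {v : σ} {S : ∀ k, List (Γ k)} (h : TM2.stepAux (M l) v S = c')
    (h' : Steps M T c' c'') : Steps M (T + 1) ⟨some l, v, S⟩ c'' :=
  ((single h).trans h').mono (by omega)

end Steps

namespace TState

variable {R : Type} [DecidableEq R]

/-- The stacks which represent a state. -/
def stk (s : TState R) : TStack R → List CodeSym
  | .inp => s.inp
  | .acc => s.out.reverse
  | .res => []
  | .reg r => List.replicate (s.reg r) .tick

theorem stk_set (s : TState R) (r : R) (m : ℕ) :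
    Function.update s.stk (.reg r) (List.replicate m .tick) = (s.set r m).stk := by
  funext k
  cases k with
  | reg a =>
    by_cases h : a = r
    · subst h; simp [stk, set]
    · rw [Function.update_of_ne (by simpa using h)]; simp [stk, set, h]
  | _ => rfl

theorem stk_push (s : TState R) (r : R) :
    Function.update s.stk (.reg r) (.tick :: s.stk (.reg r)) = (s.set r (s.reg r + 1)).stk := by
  rw [← stk_set, List.replicate_succ]; rfl

theorem stk_pop (s : TState R) (r : R) :
    Function.update s.stk (.reg r) (s.stk (.reg r)).tail = (s.set r (s.reg r - 1)).stk := by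
  rw [← stk_set]; simp [stk]

theorem stk_inp (s : TState R) (l : List CodeSym) :
    Function.update s.stk .inp l = ({ s with inp := l } : TState R).stk := by
  funext k; cases k <;> rfl

theorem stk_write (s : TState R) (a : CodeSym) :
    Function.update s.stk .acc (a :: s.stk .acc) = (s.write [a]).stk := by
  funext k; cases k <;> simp [stk, write]

theorem head?_stk_reg (s : TState R) (r : R) :
    (s.stk (.reg r)).head? = if s.reg r = 0 then none else some .tick := by
  simp only [stk]
  split_ifs with h
  · simp [h]
  · obtain ⟨m, hm⟩ := Nat.exists_eq_succ_of_ne_zero h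
    simp [hm, List.replicate_succ]

theorem write_write (s : TState R) (w w' : List CodeSym) :
    (s.write w).write w' = s.write (w ++ w') := by
  simp [write]

end TState

/-! ### Machine code of transducer programs and its simulation -/

namespace TProg

variable {R : Type} [DecidableEq R]

/-- The labels of the machine code of a program. -/
def Lab : TProg R → Type
  | emit _ | clear _ | read _ _ | copy => Unit
  | seq p q => p.Lab ⊕ q.Lab
  | loop _ _ p => Fin 3 ⊕ p.Lab
  | branch p q r => Unit ⊕ (p.Lab ⊕ (q.Lab ⊕ r.Lab))

/-- There are finitely many labels. -/
def labFintype : (p : TProg R) → Fintype p.Lab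
  | emit _ | clear _ | read _ _ | copy => inferInstanceAs (Fintype Unit)
  | seq p q =>
    letI := p.labFintype
    letI := q.labFintype
    inferInstanceAs (Fintype (p.Lab ⊕ q.Lab))
  | loop _ _ p =>
    letI := p.labFintype
    inferInstanceAs (Fintype (Fin 3 ⊕ p.Lab))
  | branch p q r =>
    letI := p.labFintype
    letI := q.labFintype
    letI := r.labFintype
    inferInstanceAs (Fintype (Unit ⊕ (p.Lab ⊕ (q.Lab ⊕ r.Lab))))

/-- The first label. -/
def entry : (p : TProg R) → p.Lab
  | emit _ | clear _ | read _ _ | copy => ()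
  | seq p _ => .inl p.entry
  | loop _ _ _ => .inl 0
  | branch _ _ _ => .inl ()

/-- Machine statements; the local variable holds the last symbol read. -/
abbrev MStmt (R Λ : Type) : Type :=
  TM2.Stmt (fun _ : TStack R => CodeSym) Λ (Option CodeSym)

/-- Pop a symbol into the local variable. -/
def popTo {Λ : Type} (k : TStack R) (q : MStmt R Λ) : MStmt R Λ :=
  .pop k (fun _ a => a) q

/-- The machine code of a program, where `e` places its labels and `x` is the label of what
comes next. -/
def code {Λ : Type} : (p : TProg R) → (p.Lab → Λ) → Λ → p.Lab → MStmt R Λ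
  | emit w, _, x, _ => w.foldr (fun a q => .push .acc (fun _ => a) q) (.goto fun _ => x)
  | clear r, e, x, l =>
    popTo (.reg r) (.branch Option.isSome (.goto fun _ => e l) (.goto fun _ => x))
  | read r r', e, x, l =>
    popTo .inp (.branch (fun a => a == some .tick)
      (.push (.reg r) (fun _ => .tick) (.push (.reg r') (fun _ => .tick) (.goto fun _ => e l)))
      (.branch Option.isSome (.push (.reg r') (fun _ => .tick) (.goto fun _ => x))
        (.goto fun _ => x)))
  | copy, e, x, l =>
    popTo .inp (.branch Option.isSome
      (.push .acc (fun a => a.getD .sep)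
        (.branch (fun a => a == some .sep) (.goto fun _ => x) (.goto fun _ => e l)))
      (.goto fun _ => x))
  | seq p q, e, x, l =>
    match l with
    | .inl l => p.code (fun l => e (.inl l)) (e (.inr q.entry)) l
    | .inr l => q.code (fun l => e (.inr l)) x l
  | loop r i p, e, x, l =>
    match l with
    | .inl 0 => popTo (.reg r) (.branch Option.isSome (.goto fun _ => e (.inr p.entry))
        (.goto fun _ => e (.inl 2)))
    | .inl 1 => .push (.reg i) (fun _ => .tick) (.goto fun _ => e (.inl 0))
    | .inl 2 => popTo (.reg i) (.branch Option.isSome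
        (.push (.reg r) (fun _ => .tick) (.goto fun _ => e (.inl 2))) (.goto fun _ => x))
    | .inr l => p.code (fun l => e (.inr l)) (e (.inl 1)) l
  | branch p q r, e, x, l =>
    match l with
    | .inl _ => popTo .inp (.branch (fun a => a == some .opAdd)
        (.goto fun _ => e (.inr (.inl p.entry)))
        (.branch (fun a => a == some .opSub) (.goto fun _ => e (.inr (.inr (.inl q.entry))))
          (.goto fun _ => e (.inr (.inr (.inr r.entry))))))
    | .inr (.inl l) => p.code (fun l => e (.inr (.inl l))) x l
    | .inr (.inr (.inl l)) => q.code (fun l => e (.inr (.inr (.inl l)))) x l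
    | .inr (.inr (.inr l)) => r.code (fun l => e (.inr (.inr (.inr l)))) x l

open Polynomial in
/-- A bound for the running time in terms of the size of the initial state. -/
noncomputable def cost : TProg R → ℕ[X]
  | emit _ => 1
  | clear _ | read _ _ | copy => X + 1
  | seq p q => p.cost + q.cost
  | loop _ _ p => X * (p.cost + 2) + 1 + (X + 1)
  | branch p q r => p.cost + q.cost + r.cost + 1

section Simulation

variable {Λ : Type} {M : Λ → MStmt R Λ}

/-- A machine statement runs all its pushes up to the next `goto`, so a fixed word costs a single
step. -/
theorem stepAux_emit (w : List CodeSym) (x : Λ) (v : Option CodeSym) (s : TState R) :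
    TM2.stepAux (w.foldr (fun a q => .push .acc (fun _ => a) q) (.goto fun _ => x) : MStmt R Λ)
      v s.stk = ⟨some x, v, (s.write w).stk⟩ := by
  induction w generalizing s with
  | nil => simp [TState.write]
  | cons a w ih =>
    rw [List.foldr_cons, TM2.stepAux, TState.stk_write, ih, TState.write_write]; rfl

theorem sim_clear {r : R} {l x : Λ}
    (hM : M l = popTo (.reg r) (.branch Option.isSome (.goto fun _ => l) (.goto fun _ => x)))
    (s : TState R) (v : Option CodeSym) :
    Steps M (s.reg r + 1) ⟨some l, v, s.stk⟩ ⟨some x, none, (s.set r 0).stk⟩ := by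
  generalize hm : s.reg r = m
  induction m generalizing s v with
  | zero =>
    refine (Steps.single ?_).mono (by omega)
    rw [hM, popTo, TM2.stepAux, TM2.stepAux, TState.stk_pop, TState.head?_stk_reg]
    simp [hm]
  | succ m ih =>
    have := ih (s.set r m) (some .tick) (by simp [TState.set])
    have h2 : (s.set r m).set r 0 = s.set r 0 := by simp [TState.set]
    rw [h2] at this
    refine this.head ?_
    rw [hM, popTo, TM2.stepAux, TM2.stepAux, TState.stk_pop, TState.head?_stk_reg]
    simp [hm]

theorem sim_restore {r i : R} (hri : r ≠ i) {l x : Λ}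
    (hM : M l = popTo (.reg i) (.branch Option.isSome
        (.push (.reg r) (fun _ => .tick) (.goto fun _ => l)) (.goto fun _ => x)))
    (s : TState R) (v : Option CodeSym) :
    Steps M (s.reg i + 1) ⟨some l, v, s.stk⟩
      ⟨some x, none, ((s.set r (s.reg r + s.reg i)).set i 0).stk⟩ := by
  generalize hm : s.reg i = m
  induction m generalizing s v with
  | zero =>
    refine (Steps.single ?_).mono (by omega)
    rw [hM, popTo, TM2.stepAux, TM2.stepAux, TState.stk_pop, TState.head?_stk_reg]
    simp [hm, TState.set]
  | succ m ih =>
    have := ih ((s.set i m).set r (s.reg r + 1)) (some .tick) (by simp [TState.set, hri.symm])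
    have h2 : (((s.set i m).set r (s.reg r + 1)).set r
        (((s.set i m).set r (s.reg r + 1)).reg r + m)).set i 0 =
        (s.set r (s.reg r + (m + 1))).set i 0 := by
      ext1
      · rfl
      · funext a
        by_cases h : a = i
        · subst h; simp [TState.set]
        · by_cases h' : a = r
          · subst h'; simp [TState.set, hri]; omega
          · simp [TState.set, h, h']
      · rfl
    rw [h2] at this
    refine this.head ?_
    rw [hM, popTo, TM2.stepAux, TM2.stepAux, TState.stk_pop, TState.head?_stk_reg]
    simp only [hm, Nat.add_one_ne_zero, if_false, Option.isSome_some, cond_true, TM2.stepAux,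
      TState.stk_push, Nat.add_one_sub_one]
    simp [TState.set, hri]

/-- The final local variable is left existential: it depends on whether the input ran out, and every
later fragment accepts any value. -/
theorem sim_read {r r' : R} {l x : Λ}
    (hM : M l = popTo .inp (.branch (fun a => a == some .tick)
      (.push (.reg r) (fun _ => .tick) (.push (.reg r') (fun _ => .tick) (.goto fun _ => l)))
      (.branch Option.isSome (.push (.reg r') (fun _ => .tick) (.goto fun _ => x))
        (.goto fun _ => x))))
    (s : TState R) (v : Option CodeSym) :
    ∃ v', Steps M (s.inp.length + 1) ⟨some l, v, s.stk⟩
      ⟨some x, v', (s.readTicks r r' s.inp).stk⟩ := by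
  generalize hm : s.inp = w
  induction w generalizing s v with
  | nil =>
    refine ⟨none, (Steps.single ?_).mono (by omega)⟩
    rw [hM, popTo, TM2.stepAux, TM2.stepAux, TState.stk_inp]
    simp [hm, TState.stk, TState.readTicks]
  | cons a w ih =>
    by_cases ha : a = .tick
    · subst ha
      obtain ⟨v', h⟩ := ih (({ s with inp := w }.set r (s.reg r + 1)).set r'
        ((s.set r (s.reg r + 1)).reg r' + 1)) (some .tick) rfl
      refine ⟨v', ?_⟩
      rw [TState.readTicks]
      refine h.head ?_
      rw [hM, popTo, TM2.stepAux, TM2.stepAux, TState.stk_inp]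
      have h1 : (s.stk .inp).head? = some .tick := by simp [TState.stk, hm]
      have h2 : (s.stk .inp).tail = w := by simp [TState.stk, hm]
      rw [h1, h2]
      simp only [beq_self_eq_true, cond_true, TM2.stepAux, TState.stk_push]
      rfl
    · refine ⟨some a, ?_⟩
      refine (Steps.single ?_).mono (by omega)
      rw [hM, popTo, TM2.stepAux, TM2.stepAux, TState.stk_inp]
      have h1 : (s.stk .inp).head? = some a := by simp [TState.stk, hm]
      have h2 : (s.stk .inp).tail = w := by simp [TState.stk, hm]
      have h3 : (some a == some CodeSym.tick) = false := by simp [ha]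
      rw [h1, h2, h3]
      simp only [cond_false, TM2.stepAux, TState.stk_push, Option.isSome_some, cond_true]
      rw [TState.readTicks]
      exact ha

theorem sim_copy {l x : Λ}
    (hM : M l = popTo .inp (.branch Option.isSome
      (.push .acc (fun a => a.getD .sep)
        (.branch (fun a => a == some .sep) (.goto fun _ => x) (.goto fun _ => l)))
      (.goto fun _ => x)))
    (s : TState R) (v : Option CodeSym) :
    ∃ v', Steps M (s.inp.length + 1) ⟨some l, v, s.stk⟩
      ⟨some x, v', (s.copySep s.inp).stk⟩ := by
  generalize hm : s.inp = w
  induction w generalizing s v with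
  | nil =>
    refine ⟨none, (Steps.single ?_).mono (by omega)⟩
    rw [hM, popTo, TM2.stepAux, TM2.stepAux, TState.stk_inp]
    simp [hm, TState.stk, TState.copySep]
  | cons a w ih =>
    have h1 : (s.stk .inp).head? = some a := by simp [TState.stk, hm]
    have h2 : (s.stk .inp).tail = w := by simp [TState.stk, hm]
    rw [TState.copySep]
    split_ifs with ha
    · refine ⟨some a, ?_⟩
      refine (Steps.single ?_).mono (by omega)
      rw [hM, popTo, TM2.stepAux, TM2.stepAux, TState.stk_inp, h1, h2]
      simp only [cond_true, TM2.stepAux, TState.stk_write, Option.isSome_some, Option.getD_some]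
      simp [ha]
    · obtain ⟨v', h⟩ := ih ({ s with inp := w }.write [a]) (some a) rfl
      refine ⟨v', h.head ?_⟩
      rw [hM, popTo, TM2.stepAux, TM2.stepAux, TState.stk_inp, h1, h2]
      have h3 : (some a == some CodeSym.sep) = false := by simp [ha]
      simp only [cond_true, TM2.stepAux, TState.stk_write, Option.isSome_some, Option.getD_some,
        h3, cond_false]

variable [Fintype R]

/-- A round costs the body plus two steps, for popping `r` and pushing `i`. One more step detects
that `r` is empty, and restoring `r` from `i` takes at most `B + 1`. The same `B` serves all rounds
because the size does not grow. -/
theorem sim_loop {r i : R} {p : TProg R} (hp : (loop r i p).WF) {l0 l1 l2 lp x : Λ}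
    (hM0 : M l0 = popTo (.reg r) (.branch Option.isSome (.goto fun _ => lp) (.goto fun _ => l2)))
    (hM1 : M l1 = .push (.reg i) (fun _ => .tick) (.goto fun _ => l0))
    (hM2 : M l2 = popTo (.reg i) (.branch Option.isSome
        (.push (.reg r) (fun _ => .tick) (.goto fun _ => l2)) (.goto fun _ => x)))
    {B T : ℕ} (ih : ∀ (s : TState R) (v : Option CodeSym), s.size ≤ B → ∃ v',
      Steps M T ⟨some lp, v, s.stk⟩ ⟨some l1, v', (p.eval s).stk⟩)
    (s : TState R) (hB : s.size ≤ B) (v : Option CodeSym) :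
    ∃ v', Steps M (B * (T + 2) + 1 + (B + 1)) ⟨some l0, v, s.stk⟩
      ⟨some x, v', ((loop r i p).eval s).stk⟩ := by
  have key : ∀ m (u : TState R) v, u.reg r = m → u.size ≤ B → ∃ v',
      Steps M (m * (T + 2) + 1) ⟨some l0, v, u.stk⟩
        ⟨some l2, v', ((fun u : TState R => (p.eval (u.set r (u.reg r - 1))).set i
        ((p.eval (u.set r (u.reg r - 1))).reg i + 1))^[m] u).stk⟩ ∧
      ((fun u : TState R => (p.eval (u.set r (u.reg r - 1))).set i
        ((p.eval (u.set r (u.reg r - 1))).reg i + 1))^[m] u).size ≤ B := by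
    intro m
    induction m with
    | zero =>
      intro u v hu hB
      refine ⟨none, (Steps.single ?_).mono (by omega), hB⟩
      rw [hM0, popTo, TM2.stepAux, TM2.stepAux, TState.stk_pop, TState.head?_stk_reg]
      simp only [hu, TState.set, if_true, Option.isSome_none, cond_false, TM2.stepAux,
        Function.iterate_zero, id]
      rw [Nat.zero_sub, ← hu, Function.update_eq_self]
    | succ m ihm =>
      intro u v hu hB
      have h1 := TState.size_set u r (u.reg r - 1)
      obtain ⟨v1, h2⟩ := ih (u.set r (u.reg r - 1)) (some .tick) (by omega)
      obtain ⟨v2, h3, h4⟩ := ihm _ v1 (by rw [reg_loop_body hp.1 hp.2.1, hu]; rfl)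
        ((size_loop_body (size_eval p hp.2.2) u (by omega)).trans hB)
      rw [Function.iterate_succ_apply]
      refine ⟨v2, ?_, h4⟩
      have h5 : Steps M 1 ⟨some l1, v1, (p.eval (u.set r (u.reg r - 1))).stk⟩ _ :=
        Steps.single (by rw [hM1, TM2.stepAux, TM2.stepAux, TState.stk_push])
      refine (Steps.head ?_ (h2.trans (h5.trans h3))).mono ?_
      · rw [hM0, popTo, TM2.stepAux, TM2.stepAux, TState.stk_pop, TState.head?_stk_reg]
        simp [hu]
      · rw [Nat.succ_mul]; omega
  obtain ⟨v1, h1, h2⟩ := key _ s v rfl hB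
  refine ⟨none, (h1.trans (sim_restore hp.1 hM2 _ v1)).mono ?_⟩
  have h3 := TState.reg_le_size ((fun u : TState R => (p.eval (u.set r (u.reg r - 1))).set i
        ((p.eval (u.set r (u.reg r - 1))).reg i + 1))^[s.reg r] s) i
  have h4 := Nat.mul_le_mul_right (T + 2) ((s.reg_le_size r).trans hB)
  omega

theorem sim_branch {p q r : TProg R} {l lp lq lr x : Λ}
    (hM : M l = popTo .inp (.branch (fun a => a == some .opAdd) (.goto fun _ => lp)
        (.branch (fun a => a == some .opSub) (.goto fun _ => lq) (.goto fun _ => lr))))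
    {B Tp Tq Tr : ℕ}
    (ihp : ∀ (s : TState R) (v : Option CodeSym), s.size ≤ B → ∃ v',
      Steps M Tp ⟨some lp, v, s.stk⟩ ⟨some x, v', (p.eval s).stk⟩)
    (ihq : ∀ (s : TState R) (v : Option CodeSym), s.size ≤ B → ∃ v',
      Steps M Tq ⟨some lq, v, s.stk⟩ ⟨some x, v', (q.eval s).stk⟩)
    (ihr : ∀ (s : TState R) (v : Option CodeSym), s.size ≤ B → ∃ v',
      Steps M Tr ⟨some lr, v, s.stk⟩ ⟨some x, v', (r.eval s).stk⟩)
    (s : TState R) (hB : s.size ≤ B) (v : Option CodeSym) :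
    ∃ v', Steps M (Tp + Tq + Tr + 1) ⟨some l, v, s.stk⟩
      ⟨some x, v', ((branch p q r).eval s).stk⟩ := by
  have hB' : ({ s with inp := s.inp.tail } : TState R).size ≤ B :=
    le_trans (by simp only [TState.size, List.length_tail]; omega) hB
  have h1 : (s.stk .inp).head? = s.inp.head? := rfl
  have h2 : (s.stk .inp).tail = s.inp.tail := rfl
  simp only [eval]
  split_ifs with ha hb
  · obtain ⟨v1, h⟩ := ihp _ (some .opAdd) hB'
    refine ⟨v1, (h.head ?_).mono (by omega)⟩
    rw [hM, popTo, TM2.stepAux, TM2.stepAux, TState.stk_inp, h1, h2]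
    simp [ha]
  · obtain ⟨v1, h⟩ := ihq _ (some .opSub) hB'
    refine ⟨v1, (h.head ?_).mono (by omega)⟩
    rw [hM, popTo, TM2.stepAux, TM2.stepAux, TState.stk_inp, h1, h2, hb]
    rfl
  · obtain ⟨v1, h⟩ := ihr _ s.inp.head? hB'
    refine ⟨v1, (h.head ?_).mono (by omega)⟩
    rw [hM, popTo, TM2.stepAux, TM2.stepAux, TState.stk_inp, h1, h2]
    have h3 : (s.inp.head? == some CodeSym.opAdd) = false := by simpa using ha
    have h4 : (s.inp.head? == some CodeSym.opSub) = false := by simpa using hb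
    simp [h3, h4]

/-- The machine code of a program simulates the program. -/
theorem sim (p : TProg R) (hp : p.WF) (e : p.Lab → Λ) (x : Λ)
    (hM : ∀ l, M (e l) = p.code e x l) (s : TState R) (B : ℕ) (hB : s.size ≤ B)
    (v : Option CodeSym) :
    ∃ v', Steps M (p.cost.eval B) ⟨some (e p.entry), v, s.stk⟩ ⟨some x, v', (p.eval s).stk⟩ := by
  induction p generalizing x s v with
  | emit w =>
    refine ⟨v, (Steps.single ?_).mono (by simp [cost])⟩
    rw [hM]
    exact stepAux_emit w x v s
  | clear r =>
    exact ⟨none, (sim_clear (hM ()) s v).mono (by simpa [cost] using (s.reg_le_size r).trans hB)⟩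
  | read r r' =>
    obtain ⟨v', h⟩ := sim_read (hM ()) s v
    exact ⟨v', h.mono (by simp only [TState.size] at hB; simp [cost]; omega)⟩
  | copy =>
    obtain ⟨v', h⟩ := sim_copy (hM ()) s v
    exact ⟨v', h.mono (by simp only [TState.size] at hB; simp [cost]; omega)⟩
  | seq p q ihp ihq =>
    obtain ⟨v1, h1⟩ := ihp hp.1 (fun l => e (.inl l)) (e (.inr q.entry)) (fun l => hM (.inl l))
      s hB v
    obtain ⟨v2, h2⟩ := ihq hp.2 (fun l => e (.inr l)) x (fun l => hM (.inr l))
      (p.eval s) ((size_eval p hp.1 s).trans hB) v1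
    exact ⟨v2, (h1.trans h2).mono (by simp [cost])⟩
  | loop r i p ih =>
    obtain ⟨v1, h⟩ := sim_loop hp (hM (.inl 0)) (hM (.inl 1)) (hM (.inl 2))
      (fun s v hs => ih hp.2.2 (fun l => e (.inr l)) (e (.inl 1)) (fun l => hM (.inr l)) s hs v)
      s hB v
    exact ⟨v1, h.mono (by simp [cost])⟩
  | branch p q r ihp ihq ihr =>
    obtain ⟨v1, h⟩ := sim_branch (hM (.inl ()))
      (fun s v hs => ihp hp.1 (fun l => e (.inr (.inl l))) x (fun l => hM (.inr (.inl l))) s hs v)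
      (fun s v hs => ihq hp.2.1 (fun l => e (.inr (.inr (.inl l)))) x
        (fun l => hM (.inr (.inr (.inl l)))) s hs v)
      (fun s v hs => ihr hp.2.2 (fun l => e (.inr (.inr (.inr l)))) x
        (fun l => hM (.inr (.inr (.inr l)))) s hs v)
      s hB v
    exact ⟨v1, h.mono (by simp [cost])⟩

/-- Output is accumulated with its last symbol on top. Reversing it yields the required order and
empties the accumulator; the last pop leaves the local variable at `none`, as a halting
configuration demands. -/
theorem sim_reverse {l : Λ}
    (hM : M l = popTo .acc (.branch Option.isSome
        (.push .res (fun a => a.getD .sep) (.goto fun _ => l)) .halt))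
    (w w' : List CodeSym) (v : Option CodeSym) (S : TStack R → List CodeSym) (hacc : S .acc = w)
    (hres : S .res = w') :
    Steps M (w.length + 1) ⟨some l, v, S⟩
      ⟨none, none, Function.update (Function.update S .acc []) .res (w.reverse ++ w')⟩ := by
  induction w generalizing w' v S with
  | nil =>
    refine Steps.single ?_
    simp only [hM, popTo, TM2.stepAux, hacc]
    simp [← hres]
  | cons a w ih =>
    have h := ih (a :: w') (some a) (Function.update (Function.update S .acc w) .res (a :: w'))
      (by simp) (by simp)
    have h2 : Function.update (Function.update (Function.update (Function.update S .acc w) .res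
        (a :: w')) .acc []) .res (w.reverse ++ a :: w') =
        Function.update (Function.update S .acc []) .res (w.reverse ++ a :: w') := by
      funext k
      cases k <;> simp [Function.update]
    rw [h2] at h
    simp only [List.reverse_cons, List.append_assoc, List.singleton_append]
    refine h.head ?_
    simp only [hM, popTo, TM2.stepAux, hacc]
    simp [hres]

end Simulation

open Polynomial in
/-- A bound for the number of symbols written in terms of the size of the initial state. -/
noncomputable def outBound : TProg R → ℕ[X]
  | emit w => C w.length
  | clear _ | read _ _ => 0
  | copy => X
  | seq p q => p.outBound + q.outBound
  | loop _ _ p => X * p.outBound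
  | branch p q r => p.outBound + q.outBound + r.outBound

theorem out_readTicks (r r' : R) (l : List CodeSym) (s : TState R) :
    (s.readTicks r r' l).out = s.out := by
  induction l generalizing s with
  | nil => rfl
  | cons a l ih =>
    by_cases ha : a = .tick
    · subst ha; rw [TState.readTicks, ih]; rfl
    · rw [TState.readTicks]
      · rfl
      · exact ha

theorem length_out_copySep (l : List CodeSym) (s : TState R) :
    (s.copySep l).out.length ≤ s.out.length + l.length := by
  induction l generalizing s with
  | nil => exact le_rfl
  | cons a l ih =>
    rw [TState.copySep]
    split_ifs
    · simp [TState.write]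
    · refine (ih _).trans ?_
      simp [TState.write]; omega

/-- The final reversal takes time linear in the output, so the output length needs its own
polynomial bound. -/
theorem length_out_eval [Fintype R] (p : TProg R) (hp : p.WF) (s : TState R) (B : ℕ)
    (hB : s.size ≤ B) : (p.eval s).out.length ≤ s.out.length + p.outBound.eval B := by
  induction p generalizing s with
  | emit w => simp [eval, outBound, TState.write]
  | clear r => simp [eval, outBound, TState.set]
  | read r r' => simp [eval, outBound, out_readTicks]
  | copy =>
    refine (length_out_copySep _ s).trans ?_
    simp only [TState.size] at hB
    simp only [outBound, Polynomial.eval_X]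
    omega
  | seq p q ihp ihq =>
    have h1 := ihp hp.1 s hB
    have h2 := ihq hp.2 (p.eval s) ((size_eval p hp.1 s).trans hB)
    simp only [eval, outBound, Polynomial.eval_add]
    omega
  | loop r i p ih =>
    have key : ∀ m (u : TState R), u.reg r = m → u.size ≤ B →
        ((fun u : TState R => (p.eval (u.set r (u.reg r - 1))).set i
          ((p.eval (u.set r (u.reg r - 1))).reg i + 1))^[m] u).out.length ≤
          u.out.length + m * p.outBound.eval B := by
      intro m
      induction m with
      | zero => intro u _ _; simp
      | succ m ihm =>
        intro u hu hB
        rw [Function.iterate_succ_apply]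
        have h1 := TState.size_set u r (u.reg r - 1)
        refine (ihm _ (by rw [reg_loop_body hp.1 hp.2.1, hu]; rfl)
          ((size_loop_body (size_eval p hp.2.2) u (by omega)).trans hB)).trans ?_
        have h2 := ih hp.2.2 (u.set r (u.reg r - 1)) (by omega)
        simp only [TState.set] at h2 ⊢
        rw [Nat.succ_mul]
        omega
    have h1 := key _ s rfl hB
    have h2 := Nat.mul_le_mul_right (p.outBound.eval B) ((s.reg_le_size r).trans hB)
    simp only [eval, outBound, Polynomial.eval_mul, Polynomial.eval_X]
    simp only [TState.set] at h1 ⊢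
    omega
  | branch p q r ihp ihq ihr =>
    have hB' : ({ s with inp := s.inp.tail } : TState R).size ≤ B :=
      le_trans (by simp only [TState.size, List.length_tail]; omega) hB
    have h1 := ihp hp.1 _ hB'
    have h2 := ihq hp.2.1 _ hB'
    have h3 := ihr hp.2.2 _ hB'
    simp only [eval, outBound, Polynomial.eval_add]
    split_ifs <;> simp only at h1 h2 h3 ⊢ <;> omega

/-- The machine which runs a program and then reverses the accumulated output. -/
def machine [Fintype R] (p : TProg R) : FinTM2 where
  K := TStack R
  k₀ := .inp
  k₁ := .res
  Γ _ := CodeSym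
  Λ := p.Lab ⊕ Unit
  main := .inl p.entry
  ΛFin := letI := p.labFintype; inferInstance
  σ := Option CodeSym
  initialState := none
  m := Sum.elim (p.code .inl (.inr ())) fun _ => popTo .acc (.branch Option.isSome
        (.push .res (fun a => a.getD .sep) (.goto fun _ => .inr ())) .halt)

/-- A function which is computed on codes by a well-formed transducer program is computable in
polynomial time. -/
theorem polyTime {α β : Type} [Fintype R] (p : TProg R) (hp : p.WF)
    (ea : α → List CodeSym) (eb : β → List CodeSym) (f : α → β)
    (h : ∀ a, p.eval ⟨ea a, fun _ => 0, []⟩ = ⟨[], fun _ => 0, eb (f a)⟩) :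
    Nonempty (TM2ComputableInPolyTime ea eb f) := by
  have key : ∀ a, Steps p.machine.m
      ((((p.cost + p.outBound + 1).comp (2 * Polynomial.X : Polynomial ℕ))).eval (ea a).length)
      (initList p.machine (ea a)) (haltList p.machine (eb (f a))) := by
    intro a
    -- With all registers zero only the input counts, with weight 2; hence the composition with `2 *
    -- X` in the time bound.
    have hs : (⟨ea a, fun _ => 0, []⟩ : TState R).size ≤ 2 * (ea a).length := by
      simp [TState.size]
    obtain ⟨v, h1⟩ := sim (M := p.machine.m) p hp Sum.inl (Sum.inr ()) (fun _ => rfl) _ _ hs none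
    have h2 := length_out_eval p hp _ _ hs
    rw [h] at h1 h2
    have h3 := sim_reverse (M := p.machine.m) (l := Sum.inr ()) rfl (eb (f a)).reverse [] v
      (TState.stk ⟨[], fun _ => 0, eb (f a)⟩) rfl rfl
    rw [List.reverse_reverse, List.append_nil] at h3
    have h4 : initList p.machine (ea a) = ⟨some (Sum.inl p.entry), none,
        TState.stk ⟨ea a, fun _ => 0, []⟩⟩ := by
      unfold initList
      congr 1
      funext k
      cases k <;> rfl
    have h5 : haltList p.machine (eb (f a)) = ⟨none, none, Function.update (Function.update
        (TState.stk ⟨[], fun _ : R => 0, eb (f a)⟩) .acc []) .res (eb (f a))⟩ := by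
      unfold haltList
      congr 1
      funext k
      cases k <;> rfl
    rw [h4, h5]
    refine (h1.trans h3).mono ?_
    simp only [List.length_nil, zero_add] at h2
    simp only [Polynomial.eval_comp, Polynomial.eval_add, Polynomial.eval_mul, Polynomial.eval_X,
      Polynomial.eval_one, Polynomial.eval_ofNat, List.length_reverse]
    omega
  choose t ht hstep using key
  exact ⟨{ tm := p.machine
           inputAlphabet := Equiv.refl _
           outputAlphabet := Equiv.refl _
           time := _
           outputsFun := fun a =>
            { steps := t a
              evals_in_steps := by
                have hid : ∀ w : List CodeSym, w.map (Equiv.refl CodeSym).invFun = w :=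
                  List.map_id
                have := hstep a
                rw [← hid (ea a), ← hid (eb (f a))] at this
                exact this
              steps_le_m := ht a } }⟩

end TProg

/-! ### The straight-line program of a counter program -/

/-- The variables of the straight-line program. There is a cell for every instruction address
and every counter, and one more for every address. -/
inductive SimVar (n L : ℕ) : Type
  /-- constantly zero -/
  | zero
  /-- constantly one -/
  | one
  /-- one plus the number of simulated steps minus the number of passes -/
  | excess
  | gap
  | low
  | high
  /-- the value of counter `k` if the current address is `p`, and zero otherwise; for `k = n`,
  the indicator of `p` being the current address -/
  | cell (p : Fin (L + 1)) (k : Fin (n + 1))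
  deriving DecidableEq

/-- The command `x ← max (a + b - c, d + e - f)`. -/
structure MaxCmd (V : Type) : Type where
  target : V
  a : V
  b : V
  c : V
  d : V
  e : V
  f : V

namespace MaxCmd

variable {V : Type}

/-- The command `x ← a + b - c`. -/
def lin (x a b c : V) : MaxCmd V := ⟨x, a, b, c, a, b, c⟩

variable [DecidableEq V]

/-- The effect of a command. -/
def sem (m : MaxCmd V) (w : V → ℤ) : V → ℤ :=
  Function.update w m.target (max (w m.a + w m.b - w m.c) (w m.d + w m.e - w m.f))

/-- The effect of a sequence of commands. -/
def semList (l : List (MaxCmd V)) (w : V → ℤ) : V → ℤ := l.foldl (fun w m => m.sem w) w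

theorem semList_cons (m : MaxCmd V) (l : List (MaxCmd V)) (w : V → ℤ) :
    semList (m :: l) w = semList l (m.sem w) := rfl

theorem semList_nil (w : V → ℤ) : semList [] w = w := rfl

theorem semList_append (l l' : List (MaxCmd V)) (w : V → ℤ) :
    semList (l ++ l') w = semList l' (semList l w) := List.foldl_append

theorem sem_lin (x a b c : V) (w : V → ℤ) :
    (lin x a b c).sem w = Function.update w x (w a + w b - w c) := by
  simp [sem, lin]

end MaxCmd

/-! ### The effect of one pass on the cells -/

namespace SimVar

open MaxCmd

variable {n L : ℕ}

/-- Move the part of cell `k` at address `p` that does not exceed `gap` to the next address, and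
the rest to address `t`. -/
def move (p : Fin L) (t : Fin (L + 1)) (k : Fin (n + 1)) : List (MaxCmd (SimVar n L)) :=
  [⟨low, zero, zero, cell p.castSucc k, zero, zero, gap⟩,
    lin high (cell p.castSucc k) low zero,
    lin (cell p.castSucc k) zero zero zero,
    lin (cell p.succ k) (cell p.succ k) zero low,
    lin (cell t k) (cell t k) high zero]

/-- Move all cells. -/
def moves (p : Fin L) (t : Fin (L + 1)) : List (MaxCmd (SimVar n L)) :=
  (List.finRange (n + 1)).flatMap (move p t)

/-- The simulation of the instruction `ins` at address `p`. -/
def instr (p : Fin L) : CPInstr n (L + 1) → List (MaxCmd (SimVar n L))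
  | .add i j k =>
    [lin excess excess (cell p.castSucc (Fin.last n)) zero,
      lin (cell p.castSucc i.castSucc) (cell p.castSucc j.castSucc) (cell p.castSucc k.castSucc)
        zero,
      lin gap zero zero zero] ++ moves p p.succ
  | .sub i j k =>
    [lin excess excess (cell p.castSucc (Fin.last n)) zero,
      lin (cell p.castSucc i.castSucc) (cell p.castSucc j.castSucc) zero
        (cell p.castSucc k.castSucc),
      lin gap zero zero zero] ++ moves p p.succ
  | .test i j t =>
    [lin excess excess (cell p.castSucc (Fin.last n)) zero,
      ⟨gap, cell p.castSucc j.castSucc, zero, cell p.castSucc i.castSucc, zero, zero, zero⟩] ++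
      List.replicate 10 (lin gap gap gap zero) ++ moves p t

/-- One pass through the instructions of a counter program. -/
def pass (C : CounterProgram) : List (MaxCmd (SimVar C.n C.len)) :=
  lin excess excess zero one :: (List.finRange C.len).flatMap fun p => instr p (C.code p)

/-- The source cell is saved and cleared before the two deposits, and deposits add up. So the
formula also holds when `t` is the source address or its successor. -/
theorem run_move (p : Fin L) (t : Fin (L + 1)) (k : Fin (n + 1)) (w : SimVar n L → ℤ)
    (hz : w zero = 0) :
    semList (move p t k) w zero = 0 ∧ semList (move p t k) w one = w one ∧
    semList (move p t k) w excess = w excess ∧ semList (move p t k) w gap = w gap ∧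
    (∀ q k', k' ≠ k → semList (move p t k) w (cell q k') = w (cell q k')) ∧
    ∀ q, semList (move p t k) w (cell q k) = (if q = p.castSucc then 0 else w (cell q k)) +
      (if q = p.succ then min (w (cell p.castSucc k)) (w gap) else 0) +
      (if q = t then w (cell p.castSucc k) - min (w (cell p.castSucc k)) (w gap) else 0) := by
  -- Only maxima are available, so `low` holds the negative of the minimum.
  have hmin : min (w (cell p.castSucc k)) (w gap) =
      - max (- w (cell p.castSucc k)) (- w gap) := by omega
  have hne : p.succ ≠ p.castSucc := (Fin.castSucc_lt_succ).ne'
  simp only [move, semList_cons, semList_nil, sem_lin, hmin]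
  refine ⟨?_, ?_, ?_, ?_, ?_, ?_⟩
  · simp [sem, hz]
  · simp [sem]
  · simp [sem]
  · simp [sem]
  · intro q k' hk
    simp [sem, hk]
  · intro q
    simp only [sem, Function.update_apply, reduceCtorEq, if_false, if_true, hz, cell.injEq,
      and_true, hne]
    by_cases h1 : q = t <;> by_cases h2 : q = p.castSucc <;> by_cases h3 : q = p.succ <;>
      simp_all <;> try ring

/-- Moves of different positions `k` touch disjoint cells and keep `gap`. Distinctness matters
because a repeated position would be split a second time. -/
theorem run_moves_aux (p : Fin L) (t : Fin (L + 1)) (l : List (Fin (n + 1))) (hl : l.Nodup)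
    (w : SimVar n L → ℤ) (hz : w zero = 0) :
    semList (l.flatMap (move p t)) w zero = 0 ∧ semList (l.flatMap (move p t)) w one = w one ∧
    semList (l.flatMap (move p t)) w excess = w excess ∧
    ∀ q k, semList (l.flatMap (move p t)) w (cell q k) =
      if k ∈ l then (if q = p.castSucc then 0 else w (cell q k)) +
        (if q = p.succ then min (w (cell p.castSucc k)) (w gap) else 0) +
        (if q = t then w (cell p.castSucc k) - min (w (cell p.castSucc k)) (w gap) else 0)
      else w (cell q k) := by
  induction l generalizing w with
  | nil => simp [semList_nil, hz]
  | cons a l ih =>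
    obtain ⟨h1, h2, h3, h4, h5, h6⟩ := run_move p t a w hz
    obtain ⟨i1, i2, i3, i4⟩ := ih (List.nodup_cons.1 hl).2 _ h1
    have ha := (List.nodup_cons.1 hl).1
    rw [List.flatMap_cons, semList_append]
    refine ⟨i1, i2.trans h2, i3.trans h3, fun q k => ?_⟩
    rw [i4]
    by_cases hk : k = a
    · subst hk
      rw [if_neg ha, h6, if_pos List.mem_cons_self]
    · rw [h4, h5 q k hk, h5 _ k hk]
      simp [hk]

theorem run_moves (p : Fin L) (t : Fin (L + 1)) (w : SimVar n L → ℤ) (hz : w zero = 0) :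
    semList (moves p t) w zero = 0 ∧ semList (moves p t) w one = w one ∧
    semList (moves p t) w excess = w excess ∧
    ∀ q k, semList (moves p t) w (cell q k) =
      (if q = p.castSucc then 0 else w (cell q k)) +
        (if q = p.succ then min (w (cell p.castSucc k)) (w gap) else 0) +
        (if q = t then w (cell p.castSucc k) - min (w (cell p.castSucc k)) (w gap) else 0) := by
  obtain ⟨h1, h2, h3, h4⟩ := run_moves_aux p t _ (List.nodup_finRange (n + 1)) w hz
  refine ⟨h1, h2, h3, fun q k => ?_⟩
  rw [moves, h4, if_pos (List.mem_finRange k)]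

/-- The cell contents of a valuation `v` at the current address. -/
def ext (v : Fin n → ℤ) : Fin (n + 1) → ℤ := Fin.snoc v 1

theorem ext_castSucc (v : Fin n → ℤ) (i : Fin n) : ext v i.castSucc = v i := by simp [ext]

theorem ext_last (v : Fin n → ℤ) : ext v (Fin.last n) = 1 := by simp [ext]

theorem ext_update (v : Fin n → ℤ) (i : Fin n) (x : ℤ) (k : Fin (n + 1)) :
    ext (Function.update v i x) k = if k = i.castSucc then x else ext v k := by
  induction k using Fin.lastCases with
  | last => simp [ext_last, (Fin.castSucc_lt_last i).ne']
  | cast k => simp [ext_castSucc, Function.update_apply]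

/-- The valuation `w` represents the address `q` and the counter values `v`. -/
structure Rep (w : SimVar n L → ℤ) (q : Fin (L + 1)) (v : Fin n → ℤ) (y : ℤ) : Prop where
  zero : w zero = 0
  one : w one = 1
  excess : w excess = y
  cell : ∀ p k, w (cell p k) = if p = q then ext v k else 0

/-- A zero cell splits into two zeros, because `min 0 gap = 0` for non-negative `gap`. -/
theorem Rep.moves_inactive {w : SimVar n L → ℤ} {q : Fin (L + 1)} {v : Fin n → ℤ} {y : ℤ}
    (h : Rep w q v y) {p : Fin L} (hp : p.castSucc ≠ q) (t : Fin (L + 1)) (hg : 0 ≤ w gap) :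
    Rep (semList (moves p t) w) q v y := by
  obtain ⟨h1, h2, h3, h4⟩ := run_moves p t w h.zero
  refine ⟨h1, h2.trans h.one, h3.trans h.excess, fun r k => ?_⟩
  rw [h4, h.cell, h.cell, if_neg hp, min_eq_left hg]
  by_cases hr : r = p.castSucc
  · simp [hr, hp]
  · simp [hr]

/-- With `gap = 0`, non-negative contents have minimum zero with `gap`, so the whole row goes to
`t`. -/
theorem Rep.moves_taken {w : SimVar n L → ℤ} {p : Fin L} {v : Fin n → ℤ} {y : ℤ}
    (h : Rep w p.castSucc v y) (t : Fin (L + 1)) (hg : w gap = 0) (hv : ∀ i, 0 ≤ v i) :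
    Rep (semList (moves p t) w) t v y := by
  obtain ⟨h1, h2, h3, h4⟩ := run_moves p t w h.zero
  refine ⟨h1, h2.trans h.one, h3.trans h.excess, fun r k => ?_⟩
  have hk : 0 ≤ ext v k := by
    induction k using Fin.lastCases with
    | last => simp [ext_last]
    | cast k => simpa [ext_castSucc] using hv k
  rw [h4, h.cell, h.cell, if_pos rfl, hg, min_eq_right hk]
  by_cases hr : r = p.castSucc <;> simp [hr]

/-- No content exceeds `gap`, so nothing is left over for `t`. The bound `1 ≤ w gap` serves the
indicator cell, whose value is 1. -/
theorem Rep.moves_next {w : SimVar n L → ℤ} {p : Fin L} {v : Fin n → ℤ} {y : ℤ}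
    (h : Rep w p.castSucc v y) (t : Fin (L + 1)) (hg : 1 ≤ w gap) (hv : ∀ i, v i ≤ w gap) :
    Rep (semList (moves p t) w) p.succ v y := by
  obtain ⟨h1, h2, h3, h4⟩ := run_moves p t w h.zero
  refine ⟨h1, h2.trans h.one, h3.trans h.excess, fun r k => ?_⟩
  have hk : ext v k ≤ w gap := by
    induction k using Fin.lastCases with
    | last => simpa [ext_last] using hg
    | cast k => simpa [ext_castSucc] using hv k
  rw [h4, h.cell, h.cell, if_pos rfl, min_eq_left hk]
  by_cases hr : r = p.castSucc <;> simp [hr]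

theorem run_double (m : ℕ) (w : SimVar n L → ℤ) (hz : w zero = 0) :
    semList (List.replicate m (lin gap gap gap zero)) w = Function.update w gap (2 ^ m * w gap) := by
  induction m generalizing w with
  | zero => simp [semList_nil]
  | succ m ih =>
    rw [List.replicate_succ, semList_cons, sem_lin, ih _ (by simpa using hz), Function.update_idem]
    congr 1
    simp [hz]
    ring

theorem Rep.update_gap {w : SimVar n L → ℤ} {q : Fin (L + 1)} {v : Fin n → ℤ} {y : ℤ}
    (h : Rep w q v y) (g : ℤ) : Rep (Function.update w SimVar.gap g) q v y :=
  ⟨by simpa using h.zero, by simpa using h.one, by simpa using h.excess, by simpa using h.cell⟩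

theorem Rep.count {w : SimVar n L → ℤ} {q : Fin (L + 1)} {v : Fin n → ℤ} {y : ℤ}
    (h : Rep w q v y) (p : Fin L) :
    Rep ((lin SimVar.excess SimVar.excess (SimVar.cell p.castSucc (Fin.last n)) SimVar.zero).sem w)
      q v (y + if p.castSucc = q then 1 else 0) := by
  rw [sem_lin]
  refine ⟨by simpa using h.zero, by simpa using h.one, ?_, by simpa using h.cell⟩
  simp [h.zero, h.excess, h.cell, ext_last]

/-- The assignment is executed at every address, active or not; `h0` says that at an inactive one it
overwrites a zero by a zero. -/
theorem Rep.assign {w : SimVar n L → ℤ} {q : Fin (L + 1)} {v : Fin n → ℤ} {y : ℤ}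
    (h : Rep w q v y) (p : Fin L) (i : Fin n) (a b c : SimVar n L)
    (h0 : p.castSucc ≠ q → w a + w b - w c = 0) :
    Rep ((lin (SimVar.cell p.castSucc i.castSucc) a b c).sem w) q
      (if p.castSucc = q then Function.update v i (w a + w b - w c) else v) y := by
  rw [sem_lin]
  by_cases hq : p.castSucc = q
  · rw [if_pos hq]
    refine ⟨by simpa using h.zero, by simpa using h.one, by simpa using h.excess, fun r k => ?_⟩
    subst hq
    rw [ext_update, Function.update_apply, h.cell]
    by_cases hr : r = p.castSucc <;> by_cases hk : k = i.castSucc <;> simp [hr, hk]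
  · rw [if_neg hq]
    refine ⟨by simpa using h.zero, by simpa using h.one, by simpa using h.excess, fun r k => ?_⟩
    rw [Function.update_apply, h.cell, h0 hq]
    split_ifs with h1 h2
    · simp only [SimVar.cell.injEq] at h1
      exact absurd (h1.1.symm.trans h2) hq
    all_goals rfl

theorem run_instr_test (p : Fin L) (i j : Fin n) (t : Fin (L + 1)) (w : SimVar n L → ℤ)
    {q : Fin (L + 1)} {v : Fin n → ℤ} {y : ℤ} (h : Rep w q v y) :
    ∃ w', semList (instr p (.test i j t)) w = semList (moves p t) w' ∧
      Rep w' q v (y + if p.castSucc = q then 1 else 0) ∧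
      w' gap = if p.castSucc = q then 1024 * max (v j - v i) 0 else 0 := by
  -- The witness is the valuation after the ten doublings, with `gap` written uniformly for the
  -- active and the inactive case.
  refine ⟨_, ?_, (h.count p).update_gap (2 ^ 10 *
    max (if p.castSucc = q then v j - v i else 0) 0), ?_⟩
  · rw [instr, semList_append, List.cons_append, List.cons_append, List.nil_append, semList_cons,
      semList_cons, run_double _ _ (by simp [MaxCmd.sem, lin, h.zero]), MaxCmd.sem, Function.update_idem]
    simp only [(h.count p).cell, (h.count p).zero, ext_castSucc, Function.update_self]
    congr 4
    split_ifs <;> simp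
  · rw [Function.update_self]
    split_ifs <;> simp

theorem Rep.instr_ne {w : SimVar n L → ℤ} {q : Fin (L + 1)} {v : Fin n → ℤ} {y : ℤ}
    (h : Rep w q v y) {p : Fin L} (hp : p.castSucc ≠ q) (ins : CPInstr n (L + 1)) :
    Rep (semList (instr p ins) w) q v y := by
  have hc := h.count p
  rw [if_neg hp, add_zero] at hc
  cases ins with
  | add i j k =>
    have ha := hc.assign p i (SimVar.cell p.castSucc j.castSucc) (SimVar.cell p.castSucc k.castSucc)
      SimVar.zero (fun _ => by simp [hc.cell, hp, hc.zero])
    rw [if_neg hp] at ha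
    rw [instr, semList_append, semList_cons, semList_cons, semList_cons, semList_nil, sem_lin gap]
    exact (ha.update_gap _).moves_inactive hp _ (by simp [ha.zero])
  | sub i j k =>
    have ha := hc.assign p i (SimVar.cell p.castSucc j.castSucc) SimVar.zero
      (SimVar.cell p.castSucc k.castSucc) (fun _ => by simp [hc.cell, hp, hc.zero])
    rw [if_neg hp] at ha
    rw [instr, semList_append, semList_cons, semList_cons, semList_cons, semList_nil, sem_lin gap]
    exact (ha.update_gap _).moves_inactive hp _ (by simp [ha.zero])
  | test i j t =>
    obtain ⟨w', h1, h2, h3⟩ := run_instr_test p i j t w h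
    rw [if_neg hp, add_zero] at h2
    rw [h1]
    exact h2.moves_inactive hp t (by rw [h3, if_neg hp])

/-- Non-negativity is required of the values after the step, since an arithmetic instruction updates
its row before moving it with `gap = 0`. The bound `hg` is used only for a failing test. -/
theorem Rep.instr_eq {C : CounterProgram} {w : SimVar C.n C.len → ℤ} {c : C.Config} {y : ℤ}
    (h : Rep w c.pc c.val y) {p : Fin C.len} (hp : p.castSucc = c.pc)
    (hv : ∀ i, 0 ≤ (C.step c).val i)
    (hg : ∀ i j t, C.code p = .test i j t → c.val i < c.val j →
      ∀ k, c.val k ≤ 1024 * (c.val j - c.val i)) :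
    Rep (semList (instr p (C.code p)) w) (C.step c).pc (C.step c).val (y + 1) := by
  obtain ⟨q, v⟩ := c
  dsimp only at hp h hg
  subst hp
  have hstep : C.step ⟨p.castSucc, v⟩ = C.exec p.succ v (C.code p) := by
    exact dif_pos p.isLt
  rw [hstep] at hv ⊢
  have hc := h.count p
  rw [if_pos rfl] at hc
  cases hcode : C.code p with
  | add i j k =>
    have ha := hc.assign p i (SimVar.cell p.castSucc j.castSucc) (SimVar.cell p.castSucc k.castSucc)
      SimVar.zero (fun h => absurd rfl h)
    simp only [if_true, hc.cell, hc.zero, ext_castSucc, sub_zero] at ha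
    rw [instr, semList_append, semList_cons, semList_cons, semList_cons, semList_nil, sem_lin gap]
    rw [hcode] at hv
    exact (ha.update_gap _).moves_taken _ (by simp [ha.zero]) hv
  | sub i j k =>
    have ha := hc.assign p i (SimVar.cell p.castSucc j.castSucc) SimVar.zero
      (SimVar.cell p.castSucc k.castSucc) (fun h => absurd rfl h)
    simp only [if_true, hc.cell, hc.zero, ext_castSucc, add_zero] at ha
    rw [instr, semList_append, semList_cons, semList_cons, semList_cons, semList_nil, sem_lin gap]
    rw [hcode] at hv
    exact (ha.update_gap _).moves_taken _ (by simp [ha.zero]) hv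
  | test i j t =>
    obtain ⟨w', h1, h2, h3⟩ := run_instr_test p i j t w h
    rw [if_pos rfl] at h2 h3
    rw [h1]
    rw [hcode] at hv
    simp only [CounterProgram.exec] at hv ⊢
    by_cases hij : v i ≥ v j
    · rw [if_pos hij] at hv ⊢
      exact h2.moves_taken t (by rw [h3, max_eq_right (by omega)]; rfl) hv
    · rw [if_neg hij] at hv ⊢
      have h4 : w' gap = 1024 * (v j - v i) := by rw [h3, max_eq_left (by omega)]
      exact h2.moves_next t (by omega) (fun k => h4 ▸ hg i j t hcode (by omega) k)

end SimVar

/-! ### Correctness of the simulation for simple counter programs -/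

namespace CounterProgram

open SimVar MaxCmd

variable {C : CounterProgram}

theorem run_succ (t : ℕ) : C.run (t + 1) = C.step (C.run t) :=
  Function.iterate_succ_apply' _ _ _

/-- At a test that fails, all counters are bounded by a multiple of the difference. -/
theorem IsSimple.le_of_test (hC : C.IsSimple) {p : Fin C.len} {i j : Fin C.n}
    {t : Fin (C.len + 1)} (hcode : C.code p = .test i j t) {c : C.Config} (hc : C.Reachable c)
    (hp : p.castSucc = c.pc) (hij : c.val i < c.val j) (k : Fin C.n) :
    c.val k ≤ 1024 * (c.val j - c.val i) := by
  obtain ⟨c₁, c₂, d₁, d₂, h1, h2, hi, hj, h⟩ := hC.2 p i j t hcode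
  obtain ⟨⟨a₁, ha₁, e₁⟩, ⟨a₂, ha₂, e₂⟩, hgap⟩ := h c hc (by rw [← hp]; rfl)
  have hnn := hC.1 c hc
  -- The test fails, so its operands differ and are `c₁` and `c₂` in some order.
  have habs : |c.val c₁ - c.val c₂| = c.val j - c.val i := by
    rcases hi with rfl | rfl <;> rcases hj with rfl | rfl
    · omega
    · rw [abs_of_neg (by omega)]; omega
    · rw [abs_of_pos (by omega)]
    · omega
  rw [habs] at hgap
  have hcase : ∀ l : Fin C.n, l = c₁ ∨ l = c₂ ∨ c.val l ≤ c.val j - c.val i := by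
    intro l
    by_cases hl1 : l.val = 0
    · exact .inl (Fin.ext (hl1.trans h1.symm))
    by_cases hl2 : l.val = 1
    · exact .inr (.inl (Fin.ext (hl2.trans h2.symm)))
    exact .inr (.inr (hgap l (by omega)))
  have hd := abs_le.1 habs.le
  have n1 := hnn c₁
  have n2 := hnn c₂
  have m1 := hnn d₁
  have m2 := hnn d₂
  -- Let `D` be the difference. If `d₁ = c₁`, the scaling forces the value 0. If `d₁ = c₂`, then `63
  -- * c.val c₂ ≤ D`, so `c.val c₁ ≤ 2 * D`. Otherwise `c.val d₁ ≤ D` and the factor is at most `64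
  -- * 12 = 768`; 1024 is a power of two above it.
  have b1 : c.val c₁ ≤ 1024 * (c.val j - c.val i) := by
    rcases hcase d₁ with rfl | rfl | hd₁ <;>
      rcases ha₁ with rfl | rfl | rfl <;> omega
  have b2 : c.val c₂ ≤ 1024 * (c.val j - c.val i) := by
    rcases hcase d₂ with rfl | rfl | hd₂ <;>
      rcases ha₂ with rfl | rfl | rfl <;> omega
  rcases hcase k with rfl | rfl | hk
  · exact b1
  · exact b2
  · omega

/-- Each block performs one step if its address is current when its turn comes, and none otherwise.
The halting address has no block, so the simulated time never passes the first halting time. The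
last clause guarantees progress when the starting address occurs in the list: either its block is
reached at that address or an earlier block has already made a step. -/
theorem IsSimple.run_instrs (hC : C.IsSimple) (l : List (Fin C.len)) (m : ℕ)
    (w : SimVar C.n C.len → ℤ) (y : ℤ) (h : Rep w (C.run m).pc (C.run m).val (y + m))
    (hm : ∀ t < m, (C.run t).pc ≠ Fin.last _) :
    ∃ m' ≥ m, Rep (semList (l.flatMap fun p => instr p (C.code p)) w) (C.run m').pc (C.run m').val
      (y + m') ∧ (∀ t < m', (C.run t).pc ≠ Fin.last _) ∧
      ((∃ p ∈ l, p.castSucc = (C.run m).pc) → m < m') := by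
  induction l generalizing m w with
  | nil => exact ⟨m, le_rfl, h, hm, by simp⟩
  | cons p l ih =>
    rw [List.flatMap_cons, semList_append]
    by_cases hp : p.castSucc = (C.run m).pc
    · have h1 := h.instr_eq hp (fun i => hC.1 _ ⟨m + 1, run_succ m⟩ i)
        (fun i j t hcode hij k => hC.le_of_test hcode ⟨m, rfl⟩ hp hij k)
      rw [← run_succ] at h1
      obtain ⟨m', hm', h2, h3, -⟩ := ih (m + 1) _ (by push_cast; rwa [← add_assoc])
        (fun t ht => by
          rcases Nat.lt_succ_iff_lt_or_eq.1 ht with ht | rfl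
          · exact hm t ht
          -- An address that carries a block is not the halting address.
          · rw [← hp]; exact (Fin.castSucc_lt_last p).ne)
      exact ⟨m', by omega, h2, h3, fun _ => by omega⟩
    · obtain ⟨m', hm', h2, h3, h4⟩ := ih m _ (h.instr_ne hp _) hm
      refine ⟨m', hm', h2, h3, ?_⟩
      rintro ⟨r, hr, hr'⟩
      rcases List.mem_cons.1 hr with rfl | hr
      · exact absurd hr' hp
      · exact h4 ⟨r, hr, hr'⟩

/-- A pass visits every address other than `halt`, so it makes at least one step unless the run has
halted. Decrementing `excess` once per pass gives the term `- P`. -/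
theorem IsSimple.iterate_pass (hC : C.IsSimple) (w : SimVar C.n C.len → ℤ)
    (h : Rep w C.initial.pc C.initial.val 1) (P : ℕ) :
    ∃ m : ℕ, Rep ((semList (pass C))^[P] w) (C.run m).pc (C.run m).val (1 - P + m) ∧
      (∀ t < m, (C.run t).pc ≠ Fin.last _) ∧ ((C.run m).pc = Fin.last _ ∨ P ≤ m) := by
  induction P with
  | zero => exact ⟨0, by simpa using (show Rep w (C.run 0).pc (C.run 0).val 1 from h), by simp, .inr le_rfl⟩
  | succ P ih =>
    obtain ⟨m, h1, h2, h3⟩ := ih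
    rw [Function.iterate_succ_apply']
    generalize (semList (pass C))^[P] w = u at h1
    have h4 : Rep ((lin SimVar.excess SimVar.excess SimVar.zero SimVar.one).sem u)
        (C.run m).pc (C.run m).val (1 - (P + 1 : ℕ) + m) := by
      rw [sem_lin]
      refine ⟨by simpa using h1.zero, by simpa using h1.one, ?_, by simpa using h1.cell⟩
      rw [Function.update_self, h1.excess, h1.zero, h1.one]
      push_cast; ring
    obtain ⟨m', hm, h5, h6, h7⟩ := hC.run_instrs (List.finRange C.len) m _ _ h4 h2
    refine ⟨m', h5, h6, ?_⟩
    by_cases hl : (C.run m).pc = Fin.last _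
    · left
      -- Once halted, the simulated time is frozen: `h6` excludes halting before `m'`.
      rcases hm.lt_or_eq with hlt | rfl
      · exact absurd hl (h6 m hlt)
      · exact hl
    · right
      have := h7 ⟨(C.run m).pc.castPred hl, List.mem_finRange _, by simp⟩
      have := h3.resolve_left hl
      omega

/-- The comparison of two variables after `N` passes decides bounded termination. -/
theorem IsSimple.haltsWithin_iff (hC : C.IsSimple) (w : SimVar C.n C.len → ℤ)
    (h : Rep w C.initial.pc C.initial.val 1) (N : ℕ) :
    C.HaltsWithin N ↔ ((semList (pass C))^[N] w) (cell (Fin.last _) (Fin.last _)) ≥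
      ((semList (pass C))^[N] w) excess := by
  obtain ⟨m, h1, h2, h3⟩ := hC.iterate_pass w h N
  rw [h1.cell, h1.excess, ext_last]
  constructor
  · rintro ⟨t, ht, hlast⟩
    -- There is no halting before `m`, so `m` is at most any halting time.
    have hm : m ≤ t := not_lt.1 fun hlt => h2 t hlt hlast
    have hpc : (C.run m).pc = Fin.last _ := by
      rcases h3 with h3 | h3
      · exact h3
      · rwa [show m = t by omega]
    rw [if_pos hpc.symm]
    omega
  · intro hge
    split_ifs at hge with hpc
    · exact ⟨m, by omega, hpc.symm⟩
    -- Without halting, `N ≤ m` makes `excess` at least 1, which exceeds the indicator 0.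
    · have := h3.resolve_left fun h => hpc h.symm
      omega

end CounterProgram

/-! ### The instance of the powering problem and its code -/

namespace SimVar

variable {n L : ℕ}

/-- The number of a variable. -/
def code : SimVar n L → ℕ
  | zero => 0
  | one => 1
  | excess => 2
  | gap => 3
  | low => 4
  | high => 5
  | cell p k => p.val * (n + 1) + k.val + 6

theorem cell_lt (p : Fin (L + 1)) (k : Fin (n + 1)) :
    p.val * (n + 1) + k.val < (L + 1) * (n + 1) := by
  have := Nat.mul_le_mul_right (n + 1) p.isLt
  rw [Nat.succ_mul] at this
  omega

theorem code_lt (v : SimVar n L) : v.code < (L + 1) * (n + 1) + 6 := by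
  cases v with
  | cell p k => have := cell_lt p k; simp only [code]; omega
  | _ => simp only [code]; omega

theorem finProdFinEquiv_cell (p : Fin (L + 1)) (k : Fin (n + 1)) :
    (⟨p.val * (n + 1) + k.val, cell_lt p k⟩ : Fin ((L + 1) * (n + 1))) =
      finProdFinEquiv (p, k) := by
  ext; simp [mul_comm, add_comm]

/-- The variable as an element of the standard finite type. -/
def index (v : SimVar n L) : Fin ((L + 1) * (n + 1) + 6) := ⟨v.code, v.code_lt⟩

theorem index_injective : Function.Injective (index (n := n) (L := L)) := by
  intro v w h
  have h : v.code = w.code := congrArg Fin.val h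
  cases v with
  | cell p k =>
    cases w with
    | cell q l =>
      have h2 : (⟨p.val * (n + 1) + k.val, cell_lt p k⟩ : Fin ((L + 1) * (n + 1))) =
          ⟨q.val * (n + 1) + l.val, cell_lt q l⟩ := Fin.ext (Nat.add_right_cancel h)
      rw [finProdFinEquiv_cell, finProdFinEquiv_cell] at h2
      have h3 := finProdFinEquiv.injective h2
      simp only [Prod.mk.injEq] at h3
      rw [h3.1, h3.2]
    | _ => simp only [code] at h; omega
  | _ => cases w <;> simp only [code] at h <;> first | rfl | omega

/-- The initial value of a cell. -/
def cellInit (init : Fin n → ℕ) (c : Fin (L + 1) × Fin (n + 1)) : ℕ :=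
  if c.1 = 0 then Fin.snoc (α := fun _ => ℕ) init 1 c.2 else 0

/-- The initial valuation. -/
def initial (init : Fin n → ℕ) : Fin ((L + 1) * (n + 1) + 6) → ℕ :=
  Fin.cons 0 (Fin.cons 1 (Fin.cons 1 (Fin.cons 0 (Fin.cons 0 (Fin.cons 0
    fun i => cellInit init (finProdFinEquiv.symm i))))))

theorem initial_cell (init : Fin n → ℕ) (p : Fin (L + 1)) (k : Fin (n + 1)) :
    initial init (cell p k).index = cellInit init (p, k) := by
  have h : initial init (cell p k).index = cellInit init (finProdFinEquiv.symm
    ⟨p.val * (n + 1) + k.val, cell_lt p k⟩) := rfl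
  rw [h, finProdFinEquiv_cell, Equiv.symm_apply_apply]

end SimVar

/-! ### Commands over numbered variables and their codes -/

namespace MaxCmd

/-- The term `x_a + x_b - x_c`. -/
def term {X : ℕ} (a b c : Fin (X + 6)) : SLPTerm (X + 6) where
  coeff := Fin.cons 1 (Fin.cons 1 (Fin.cons (-1) fun _ => 0))
  idx := Fin.cons a (Fin.cons b (Fin.cons c fun _ => 0))
  const := 0

theorem eval_term {X : ℕ} (a b c : Fin (X + 6)) (v : Fin (X + 6) → ℤ) :
    (term a b c).eval v = v a + v b - v c := by
  simp only [SLPTerm.eval, term]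
  rw [Fin.sum_univ_succ, Fin.sum_univ_succ, Fin.sum_univ_succ]
  simp only [Fin.cons_zero, Fin.cons_succ]
  simp
  ring

/-- The command over numbered variables. -/
def toCommand {X : ℕ} (m : MaxCmd (Fin (X + 6))) : SLPCommand (X + 6) where
  target := m.target
  first := term m.a m.b m.c
  rest := [term m.d m.e m.f]

/-- Renaming of variables. -/
def map {V W : Type} (g : V → W) (m : MaxCmd V) : MaxCmd W :=
  ⟨g m.target, g m.a, g m.b, g m.c, g m.d, g m.e, g m.f⟩

/-- Injectivity of the numbering ensures that an update of one numbered variable changes no other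
named variable. -/
theorem sem_toCommand {X : ℕ} {V : Type} [DecidableEq V] {g : V → Fin (X + 6)}
    (hg : Function.Injective g) (m : MaxCmd V) (v : Fin (X + 6) → ℤ) :
    (m.map g).toCommand.sem v ∘ g = m.sem (v ∘ g) := by
  simp only [SLPCommand.sem, toCommand, map, sem, List.foldl_cons, List.foldl_nil, eval_term]
  exact Function.update_comp_eq_of_injective _ hg _ _

theorem sem_map_toCommand {X : ℕ} {V : Type} [DecidableEq V] {g : V → Fin (X + 6)}
    (hg : Function.Injective g) (l : List (MaxCmd V)) (v : Fin (X + 6) → ℤ) :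
    SLP.sem (l.map fun m => (m.map g).toCommand) v ∘ g = semList l (v ∘ g) := by
  induction l generalizing v with
  | nil => rfl
  | cons m l ih =>
    rw [semList_cons, ← sem_toCommand hg, ← ih]
    rfl

/-- The code of the term `x_a + x_b - x_c` of order `X + 6`. -/
def termWord (X a b c : ℕ) : List CodeSym :=
  [.sign 1, .sign 1, .sign (-1), .sign 0, .sign 0, .sign 0] ++ (List.replicate X (.sign 0) ++
    (encUnary a ++ (encUnary b ++ (encUnary c ++ ([.sep, .sep, .sep] ++
      (List.replicate X .sep ++ [.sign 0]))))))

/-- Unused summands have coefficient 0 and default index 0, whose unary code is a lone separator;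
this produces the padding of `termWord`. -/
theorem encode_term {X : ℕ} (a b c : Fin (X + 6)) :
    (term a b c).encode = termWord X a b c := by
  simp only [SLPTerm.encode, term, encTuple, termWord]
  rw [List.ofFn_succ, List.ofFn_succ, List.ofFn_succ, List.ofFn_succ, List.ofFn_succ,
    List.ofFn_succ, List.ofFn_succ (n := X + 5), List.ofFn_succ (n := X + 4),
    List.ofFn_succ (n := X + 3)]
  simp only [Fin.cons_zero, Fin.cons_succ]
  simp [List.ofFn_const, encFin, encUnary]

/-- The code of a command of order `X + 6` in a list of commands. -/
def word (X : ℕ) (m : MaxCmd ℕ) : List CodeSym :=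
  [.tick] ++ (encUnary m.target ++ (termWord X m.a m.b m.c ++
    ([.tick] ++ (termWord X m.d m.e m.f ++ [.sep]))))

theorem encode_toCommand {X : ℕ} (m : MaxCmd (Fin (X + 6))) :
    .tick :: m.toCommand.encode = word X (m.map Fin.val) := by
  simp [SLPCommand.encode, toCommand, word, encode_term, map, encList, encFin]

end MaxCmd

theorem encList_eq {α : Type} (enc : α → List CodeSym) (l : List α) :
    encList enc l = l.flatMap (fun a => .tick :: enc a) ++ [.sep] := by
  induction l with
  | nil => rfl
  | cons a l ih => simp [encList, ih]

theorem encBinary_zero : encBinary 0 = [.sep] := rfl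

theorem encBinary_one : encBinary 1 = [.bit true, .sep] := rfl

namespace TerminationInstance

open SimVar MaxCmd

/-- The reduction. -/
def toPowering (I : TerminationInstance) : PoweringInstance where
  n := (I.program.len + 1) * (I.program.n + 1) + 6
  prog := (pass I.program).map fun m => (m.map index).toCommand
  init := initial I.program.init
  exponent := I.bound
  x := (cell (Fin.last _) (Fin.last _)).index
  y := excess.index

theorem isPositive_toPowering (I : TerminationInstance) (hI : I.program.IsSimple) :
    I.program.HaltsWithin I.bound ↔ I.toPowering.IsPositive := by
  have hrep : Rep (fun v : SimVar I.program.n I.program.len => (initial I.program.init v.index : ℤ))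
      I.program.initial.pc I.program.initial.val 1 := by
    have h2 : ∀ p k, (cellInit (L := I.program.len) I.program.init (p, k) : ℤ) =
        if p = 0 then ext (fun i => (I.program.init i : ℤ)) k else 0 := by
      intro p k
      simp only [cellInit, ext]
      split_ifs
      · induction k using Fin.lastCases with
        | last => simp
        | cast k => simp
      · rfl
    refine ⟨rfl, rfl, rfl, fun p k => ?_⟩
    simp only [initial_cell]
    exact h2 p k
  have hiter : ∀ (m : ℕ) (v : Fin _ → ℤ), (I.toPowering.prog.sem)^[m] v ∘ index =
      (semList (pass I.program))^[m] (v ∘ index) := by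
    intro m
    induction m with
    | zero => intro v; rfl
    | succ m ih =>
      intro v
      rw [Function.iterate_succ_apply, Function.iterate_succ_apply, ih]
      congr 1
      exact sem_map_toCommand index_injective _ v
  rw [hI.haltsWithin_iff _ hrep, PoweringInstance.IsPositive]
  have h := hiter I.bound fun i => (initial I.program.init i : ℤ)
  exact (by rw [ge_iff_le, ge_iff_le]; exact
    (congrArg₂ (· ≤ ·) (congrFun h excess) (congrFun h (cell (Fin.last _) (Fin.last _)))).symm.to_iff)

/-- In row-major order, the row of address 0 consists of the initial counters and the indicator 1,
and the other `L` rows vanish. The codes of the initial counters thus form one block that can be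
copied verbatim from the input. -/
theorem encTuple_initial {n L : ℕ} (init : Fin n → ℕ) :
    encTuple encBinary (initial (L := L) init) =
      [.sep, .bit true, .sep, .bit true, .sep, .sep, .sep, .sep] ++
        (encTuple encBinary init ++ ([.bit true, .sep] ++
          List.replicate (L * (n + 1)) .sep)) := by
  have h : ∀ (p : Fin (L + 1)) (k : Fin (n + 1)),
      cellInit init (finProdFinEquiv.symm ⟨p.val * (n + 1) + k.val, cell_lt p k⟩) =
        cellInit init (p, k) := fun p k => by
    rw [finProdFinEquiv_cell, Equiv.symm_apply_apply]
  simp only [encTuple, initial]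
  rw [List.ofFn_succ, List.ofFn_succ, List.ofFn_succ, List.ofFn_succ, List.ofFn_succ,
    List.ofFn_succ]
  simp only [Fin.cons_zero, Fin.cons_succ, encBinary_zero, encBinary_one, List.flatten_cons]
  rw [List.ofFn_mul]
  simp only [h]
  rw [List.ofFn_succ, List.ofFn_succ']
  have h3 : (List.replicate L (CodeSym.sep :: List.replicate n .sep)).flatten =
      List.replicate (L * (n + 1)) .sep := by
    rw [← List.replicate_succ, List.flatten_replicate_replicate]
  simp only [cellInit, if_true, Fin.snoc_castSucc, Fin.snoc_last, List.flatten_cons,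
    List.flatten_append, List.concat_eq_append]
  simp [encBinary_one]
  rw [encBinary_zero, List.flatten_flatten, List.map_replicate, List.flatten_cons,
    List.flatten_replicate_singleton, List.singleton_append, h3]

/-- The code of the constructed instance. -/
theorem encode_toPowering (I : TerminationInstance) :
    I.toPowering.encode =
      encUnary ((I.program.len + 1) * (I.program.n + 1) + 6) ++
      ([.sep, .bit true, .sep, .bit true, .sep, .sep, .sep, .sep] ++
        (encTuple encBinary I.program.init ++ ([.bit true, .sep] ++
          List.replicate (I.program.len * (I.program.n + 1)) .sep)) ++
      ((pass I.program).flatMap (fun m => word ((I.program.len + 1) * (I.program.n + 1))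
        (m.map code)) ++ [.sep] ++
      (encBinary I.bound ++
      (encUnary (I.program.len * (I.program.n + 1) + I.program.n + 6) ++ encUnary 2)))) := by
  rw [PoweringInstance.encode, toPowering]
  simp only [encTuple_initial, encList_eq, List.flatMap_map, encode_toCommand]
  rfl

end TerminationInstance

/-! ### The transducer program of the reduction -/

namespace TProg

theorem copySep_bits {R : Type} (l : List Bool) (rest : List CodeSym) (s : TState R) :
    s.copySep (l.map .bit ++ .sep :: rest) = ⟨rest, s.reg, s.out ++ (l.map .bit ++ [.sep])⟩ := by
  induction l generalizing s with
  | nil => simp [TState.copySep, TState.write]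
  | cons b l ih =>
    rw [List.map_cons, List.cons_append, TState.copySep, if_neg (by simp), ih]
    simp [TState.write]

/-! ### Specifications of transducer programs -/

section Writes

variable {R : Type} [DecidableEq R]

/-- From register values `g` the program reads nothing, writes `w` and preserves the registers. -/
def Writes (p : TProg R) (g : R → ℕ) (w : List CodeSym) : Prop :=
  ∀ inp out, p.eval ⟨inp, g, out⟩ = ⟨inp, g, out ++ w⟩

theorem writes_emit (w : List CodeSym) (g : R → ℕ) : (emit w).Writes g w := fun _ _ => rfl

theorem Writes.seq {p q : TProg R} {g : R → ℕ} {w w' : List CodeSym} (hp : p.Writes g w)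
    (hq : q.Writes g w') : (seq p q).Writes g (w ++ w') := fun inp out => by
  rw [eval, hp, hq, List.append_assoc]

theorem Writes.congr {p : TProg R} {g : R → ℕ} {w w' : List CodeSym} (hp : p.Writes g w)
    (h : w = w') : p.Writes g w' := h ▸ hp

/-- The family `inp` gives the remaining input before each round, so that the body may read. In
round `j` the register `i` holds `j`, while `r` holds only the number of rounds still to come. -/
theorem eval_loop {r i : R} (hri : r ≠ i) {p : TProg R} {g : R → ℕ} (hi : g i = 0)
    (inp w : ℕ → List CodeSym)
    (h : ∀ j < g r, ∀ out,
      p.eval ⟨inp j, Function.update (Function.update g r (g r - 1 - j)) i j, out⟩ =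
        ⟨inp (j + 1), Function.update (Function.update g r (g r - 1 - j)) i j, out ++ w j⟩)
    (out : List CodeSym) :
    (loop r i p).eval ⟨inp 0, g, out⟩ = ⟨inp (g r), g, out ++ (List.range (g r)).flatMap w⟩ := by
  have key : ∀ m ≤ g r, (fun u : TState R => (p.eval (u.set r (u.reg r - 1))).set i
      ((p.eval (u.set r (u.reg r - 1))).reg i + 1))^[m] ⟨inp 0, g, out⟩ =
      ⟨inp m, Function.update (Function.update g r (g r - m)) i m,
        out ++ (List.range m).flatMap w⟩ := by
    intro m
    induction m with
    | zero =>
      intro _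
      ext1
      · rfl
      · rw [Function.iterate_zero, id, Nat.sub_zero, Function.update_eq_self, ← hi,
          Function.update_eq_self]
      · simp
    | succ m ih =>
      intro hm
      rw [Function.iterate_succ_apply', ih (by omega)]
      have h1 : (⟨inp m, Function.update (Function.update g r (g r - m)) i m,
          out ++ (List.range m).flatMap w⟩ : TState R).set r (g r - m - 1) =
          ⟨inp m, Function.update (Function.update g r (g r - 1 - m)) i m,
            out ++ (List.range m).flatMap w⟩ := by
        simp only [TState.set]
        rw [Function.update_comm hri.symm, Function.update_idem, Nat.sub_right_comm]
      simp only [Function.update_of_ne hri, Function.update_self]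
      rw [h1, h m (by omega)]
      simp only [TState.set, Function.update_self, Function.update_idem, List.range_succ,
        List.flatMap_append, List.append_assoc, List.flatMap_cons, List.flatMap_nil,
        List.append_nil]
      rw [show g r - 1 - m = g r - (m + 1) by omega]
  simp only [eval]
  rw [key _ le_rfl]
  simp only [TState.set, Function.update_self, Function.update_of_ne hri, Nat.sub_self, zero_add]
  congr 1
  funext a
  by_cases ha : a = i
  · subst ha; simp [hi]
  · by_cases ha' : a = r
    · subst ha'; simp [hri]
    · simp [ha, ha']

theorem Writes.loop {r i : R} (hri : r ≠ i) {p : TProg R} {g : R → ℕ} (hi : g i = 0)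
    (w : ℕ → List CodeSym)
    (h : ∀ j < g r, p.Writes (Function.update (Function.update g r (g r - 1 - j)) i j) (w j)) :
    (loop r i p).Writes g ((List.range (g r)).flatMap w) := fun inp out =>
  eval_loop hri hi (fun _ => inp) w (fun j hj out => h j hj inp out) out

theorem flatMap_range_replicate {α : Type*} (m l : ℕ) (a : α) :
    (List.range m).flatMap (fun _ => List.replicate l a) = List.replicate (m * l) a := by
  induction m with
  | zero => simp
  | succ m ih => rw [List.range_succ, List.flatMap_append, ih, Nat.succ_mul, List.replicate_add]; simp

/-- Loops count natural numbers, whereas programs are indexed by `Fin`; the default `[]` is never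
reached. -/
theorem flatMap_range_dite {α : Type*} (m : ℕ) (w : Fin m → List α) :
    (List.range m).flatMap (fun j => if h : j < m then w ⟨j, h⟩ else []) =
      (List.finRange m).flatMap w := by
  rw [← List.map_coe_finRange_eq_range, List.flatMap_map]
  congr 1
  funext k
  rw [dif_pos k.isLt]

theorem flatten_drop_ofFn {α : Type*} {m : ℕ} (w : Fin m → List α) {j : ℕ} (hj : j < m) :
    ((List.ofFn w).drop j).flatten = w ⟨j, hj⟩ ++ ((List.ofFn w).drop (j + 1)).flatten := by
  rw [List.drop_eq_getElem_cons (by simpa using hj), List.flatten_cons, List.getElem_ofFn]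

/-- Write `a` as many times as the value of `r`. -/
def rep (r i : R) (a : CodeSym) : TProg R := loop r i (emit [a])

theorem writes_rep {r i : R} (hri : r ≠ i) {g : R → ℕ} (hi : g i = 0) (a : CodeSym) :
    (rep r i a).Writes g (List.replicate (g r) a) :=
  (Writes.loop hri hi _ fun _ _ => writes_emit (List.replicate 1 a) _).congr
    (by rw [flatMap_range_replicate, mul_one])

/-- Write `a` as many times as the product of the values of `r` and `r'`. -/
def rep₂ (r i r' i' : R) (a : CodeSym) : TProg R := loop r i (rep r' i' a)

theorem writes_rep₂ {r i r' i' : R} (h1 : r ≠ i) (h2 : r ≠ r') (h3 : r ≠ i') (h4 : i ≠ r')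
    (h5 : i ≠ i') (h6 : r' ≠ i') {g : R → ℕ} (hi : g i = 0) (hi' : g i' = 0) (a : CodeSym) :
    (rep₂ r i r' i' a).Writes g (List.replicate (g r * g r') a) := by
  refine (Writes.loop h1 hi (fun _ => List.replicate (g r') a) fun j _ => ?_).congr ?_
  · refine (writes_rep h6 ?_ a).congr ?_
    · simp [h3.symm, h5.symm, hi']
    · simp [h2.symm, h4.symm]
  · rw [flatMap_range_replicate]

/-- The separator is counted in `r'` but not in `r`. In this way one read supplies both a number and
its successor, such as the number of counters and the row width. -/
theorem readTicks_encUnary {r r' : R} (h : r ≠ r') (m : ℕ) (rest : List CodeSym)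
    (s : TState R) : s.readTicks r r' (encUnary m ++ rest) =
      ⟨rest, Function.update (Function.update s.reg r (s.reg r + m)) r' (s.reg r' + m + 1),
        s.out⟩ := by
  induction m generalizing s with
  | zero => simp [encUnary, TState.readTicks, TState.set]
  | succ m ih =>
    rw [encUnary, List.replicate_succ, List.cons_append, List.cons_append, TState.readTicks]
    refine (ih _).trans ?_
    ext1
    · rfl
    · simp only [TState.set, Function.update_self, Function.update_of_ne h,
        Function.update_of_ne h.symm]
      funext x
      by_cases h1 : x = r'
      · subst h1
        simp only [Function.update_self]
        omega
      · by_cases h2 : x = r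
        · subst h2
          simp only [Function.update_of_ne h1, Function.update_self]
          omega
        · simp only [Function.update_of_ne h1, Function.update_of_ne h2]
    · rfl

theorem eval_read {r r' : R} (h : r ≠ r') (m : ℕ) (rest : List CodeSym) (g : R → ℕ)
    (out : List CodeSym) :
    (read r r').eval ⟨encUnary m ++ rest, g, out⟩ =
      ⟨rest, Function.update (Function.update g r (g r + m)) r' (g r' + m + 1), out⟩ :=
  readTicks_encUnary h m rest _

theorem eval_copy (m : ℕ) (rest : List CodeSym) (g : R → ℕ) (out : List CodeSym) :
    (copy : TProg R).eval ⟨encBinary m ++ rest, g, out⟩ = ⟨rest, g, out ++ encBinary m⟩ := by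
  have := copySep_bits (Computability.encodeNat m) rest ⟨encBinary m ++ rest, g, out⟩
  rw [eval, encBinary, List.append_assoc] at *
  exact this

theorem eval_seq (p q : TProg R) (s : TState R) : (seq p q).eval s = q.eval (p.eval s) := rfl

theorem eval_clear (r : R) (s : TState R) : (clear r).eval s = s.set r 0 := rfl

theorem eval_branch_add (p q r : TProg R) (l : List CodeSym) (g : R → ℕ) (out : List CodeSym) :
    (branch p q r).eval ⟨.opAdd :: l, g, out⟩ = p.eval ⟨l, g, out⟩ := rfl

theorem eval_branch_sub (p q r : TProg R) (l : List CodeSym) (g : R → ℕ) (out : List CodeSym) :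
    (branch p q r).eval ⟨.opSub :: l, g, out⟩ = q.eval ⟨l, g, out⟩ := rfl

theorem eval_branch_test (p q r : TProg R) (l : List CodeSym) (g : R → ℕ) (out : List CodeSym) :
    (branch p q r).eval ⟨.opTest :: l, g, out⟩ = r.eval ⟨l, g, out⟩ := rfl

end Writes

/-- The registers of the reduction. -/
inductive Reg : Type
  /-- number of counters -/
  | n
  /-- number of counters plus one -/
  | width
  /-- number of instructions before `halt` -/
  | len
  /-- number of instructions -/
  | height
  /-- current address -/
  | addr
  | cnt
  | op₁
  | op₂
  | op₃
  | junk
  | tmp₁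
  | tmp₂
  deriving DecidableEq

instance : Fintype Reg where
  elems := {.n, .width, .len, .height, .addr, .cnt, .op₁, .op₂, .op₃, .junk, .tmp₁, .tmp₂}
  complete r := by cases r <;> decide

/-- Reference to a variable of the straight-line program. -/
inductive VRef : Type
  | const (m : ℕ)
  /-- the cell with address and position in the given registers -/
  | cell (p k : Reg)
  /-- the same for the next address -/
  | next (p k : Reg)

namespace VRef

/-- The number of the variable. -/
def value (g : Reg → ℕ) : VRef → ℕ
  | const m => m
  | cell p k => g p * g .width + g k + 6
  | next p k => (g p + 1) * g .width + g k + 6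

/-- The scratch registers are not used. -/
def Valid : VRef → Prop
  | const _ => True
  | cell p k | next p k => p ≠ .tmp₁ ∧ p ≠ .width ∧ p ≠ .tmp₂ ∧ k ≠ .tmp₁

theorem value_const (g : Reg → ℕ) (m : ℕ) : (const m).value g = m := rfl

theorem value_cell (g : Reg → ℕ) (p k : Reg) : (cell p k).value g = g p * g .width + g k + 6 := rfl

theorem value_next (g : Reg → ℕ) (p k : Reg) :
    (next p k).value g = (g p + 1) * g .width + g k + 6 := rfl

theorem valid_const (m : ℕ) : (const m).Valid := trivial

theorem valid_cell (p k : Reg) :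
    (cell p k).Valid ↔ p ≠ .tmp₁ ∧ p ≠ .width ∧ p ≠ .tmp₂ ∧ k ≠ .tmp₁ := Iff.rfl

theorem valid_next (p k : Reg) :
    (next p k).Valid ↔ p ≠ .tmp₁ ∧ p ≠ .width ∧ p ≠ .tmp₂ ∧ k ≠ .tmp₁ := Iff.rfl

/-- Write the number of the variable. -/
def emit : VRef → TProg Reg
  | const m => .emit (encUnary m)
  | cell p k => .seq (rep₂ p .tmp₁ .width .tmp₂ .tick) (.seq (rep k .tmp₁ .tick)
      (.emit (encUnary 6)))
  | next p k => .seq (rep₂ p .tmp₁ .width .tmp₂ .tick) (.seq (rep .width .tmp₁ .tick)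
      (.seq (rep k .tmp₁ .tick) (.emit (encUnary 6))))

theorem encUnary_add (a b : ℕ) :
    encUnary (a + b) = List.replicate a .tick ++ encUnary b := by
  rw [encUnary, encUnary, List.replicate_add, List.append_assoc]

theorem writes_emit (v : VRef) (hv : v.Valid) {g : Reg → ℕ} (h1 : g .tmp₁ = 0)
    (h2 : g .tmp₂ = 0) : v.emit.Writes g (encUnary (v.value g)) := by
  cases v with
  | const m => exact TProg.writes_emit _ _
  | cell p k =>
    obtain ⟨hp1, hp2, hp3, hk⟩ := hv
    refine ((writes_rep₂ hp1 hp2 hp3 (by decide) (by decide) (by decide) h1 h2 _).seq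
      ((writes_rep hk h1 _).seq (TProg.writes_emit _ _))).congr ?_
    rw [value, add_assoc, encUnary_add, encUnary_add]
  | next p k =>
    obtain ⟨hp1, hp2, hp3, hk⟩ := hv
    refine ((writes_rep₂ hp1 hp2 hp3 (by decide) (by decide) (by decide) h1 h2 _).seq
      ((writes_rep (by decide) h1 _).seq
        ((writes_rep hk h1 _).seq (TProg.writes_emit _ _)))).congr ?_
    rw [value, add_mul, one_mul, add_assoc, add_assoc, encUnary_add, encUnary_add, encUnary_add]

end VRef

/-! ### Programs that write commands and blocks of instructions -/

open MaxCmd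

/-- Write the code of a term. -/
def emitTerm (a b c : VRef) : TProg Reg :=
  seq (emit [.sign 1, .sign 1, .sign (-1), .sign 0, .sign 0, .sign 0])
    (seq (rep₂ .height .tmp₁ .width .tmp₂ (.sign 0)) (seq a.emit (seq b.emit (seq c.emit
      (seq (emit [.sep, .sep, .sep]) (seq (rep₂ .height .tmp₁ .width .tmp₂ .sep)
        (emit [.sign 0])))))))

/-- Write the code of a command. -/
def emitCmd (m : MaxCmd VRef) : TProg Reg :=
  seq (emit [.tick]) (seq m.target.emit (seq (emitTerm m.a m.b m.c)
    (seq (emit [.tick]) (seq (emitTerm m.d m.e m.f) (emit [.sep])))))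

/-- Write the code of a list of commands. -/
def emitCmds : List (MaxCmd VRef) → TProg Reg
  | [] => emit []
  | m :: l => seq (emitCmd m) (emitCmds l)

/-- All references of the command are valid. -/
def CmdValid (m : MaxCmd VRef) : Prop :=
  m.target.Valid ∧ m.a.Valid ∧ m.b.Valid ∧ m.c.Valid ∧ m.d.Valid ∧ m.e.Valid ∧ m.f.Valid

theorem writes_emitTerm {g : Reg → ℕ} (h1 : g .tmp₁ = 0) (h2 : g .tmp₂ = 0) {a b c : VRef}
    (ha : a.Valid) (hb : b.Valid) (hc : c.Valid) :
    (emitTerm a b c).Writes g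
      (termWord (g .height * g .width) (a.value g) (b.value g) (c.value g)) :=
  have hrep := fun s => writes_rep₂ (r := Reg.height) (i := .tmp₁) (r' := .width) (i' := .tmp₂)
    (by decide) (by decide) (by decide) (by decide) (by decide) (by decide) h1 h2 s
  (writes_emit _ _).seq ((hrep _).seq ((a.writes_emit ha h1 h2).seq ((b.writes_emit hb h1 h2).seq
    ((c.writes_emit hc h1 h2).seq ((writes_emit _ _).seq ((hrep _).seq (writes_emit _ _)))))))

theorem writes_emitCmd {g : Reg → ℕ} (h1 : g .tmp₁ = 0) (h2 : g .tmp₂ = 0) {m : MaxCmd VRef}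
    (hm : CmdValid m) :
    (emitCmd m).Writes g ((m.map (VRef.value g)).word (g .height * g .width)) :=
  (writes_emit _ _).seq ((m.target.writes_emit hm.1 h1 h2).seq
    ((writes_emitTerm h1 h2 hm.2.1 hm.2.2.1 hm.2.2.2.1).seq ((writes_emit _ _).seq
      ((writes_emitTerm h1 h2 hm.2.2.2.2.1 hm.2.2.2.2.2.1 hm.2.2.2.2.2.2).seq
        (writes_emit _ _)))))

theorem writes_emitCmds {g : Reg → ℕ} (h1 : g .tmp₁ = 0) (h2 : g .tmp₂ = 0)
    (l : List (MaxCmd VRef)) (hl : ∀ m ∈ l, CmdValid m) :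
    (emitCmds l).Writes g
      ((l.map (MaxCmd.map (VRef.value g))).flatMap (MaxCmd.word (g .height * g .width))) := by
  induction l with
  | nil => exact writes_emit _ _
  | cons m l ih =>
    exact (writes_emitCmd h1 h2 (hl m List.mem_cons_self)).seq
      (ih fun m hm => hl m (List.mem_cons_of_mem _ hm))

open SimVar (zero one excess gap low high cell)

/-- The commands of `SimVar.move`, with target cell `tgt`. -/
def moveRefs (tgt : VRef) (k : Reg) : List (MaxCmd VRef) :=
  [⟨.const 4, .const 0, .const 0, .cell .addr k, .const 0, .const 0, .const 3⟩,
    lin (.const 5) (.cell .addr k) (.const 4) (.const 0),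
    lin (.cell .addr k) (.const 0) (.const 0) (.const 0),
    lin (.next .addr k) (.next .addr k) (.const 0) (.const 4),
    lin tgt tgt (.const 5) (.const 0)]

/-- Write the code of `SimVar.moves`. -/
def emitMoves (tgt : Reg → VRef) : TProg Reg :=
  seq (loop .n .cnt (emitCmds (moveRefs (tgt .cnt) .cnt))) (emitCmds (moveRefs (tgt .n) .n))

theorem moveRefs_valid {tgt : VRef} (ht : tgt.Valid) {k : Reg} (hk : k ≠ .tmp₁) :
    ∀ m ∈ moveRefs tgt k, CmdValid m := by
  simp [moveRefs, CmdValid, lin, VRef.valid_const, VRef.valid_cell, VRef.valid_next, hk, ht]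

/-- The registers hold the size of the program, the current address and the position `k`. -/
structure RegsAt (g : Reg → ℕ) (n L p : ℕ) : Prop where
  width : g .width = n + 1
  height : g .height = L + 1
  addr : g .addr = p
  tmp₁ : g .tmp₁ = 0
  tmp₂ : g .tmp₂ = 0

theorem writes_moveRefs {n L : ℕ} {g : Reg → ℕ} {p : Fin L} (hg : RegsAt g n L p) {tgt : VRef}
    (ht : tgt.Valid) {k : Reg} (hk : k ≠ .tmp₁) {t : Fin (L + 1)} {k' : Fin (n + 1)}
    (hk' : g k = k') (htgt : tgt.value g = (cell (n := n) t k').code) :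
    (emitCmds (moveRefs tgt k)).Writes g ((SimVar.move (n := n) p t k').flatMap fun m =>
      (m.map SimVar.code).word ((L + 1) * (n + 1))) := by
  refine (writes_emitCmds hg.tmp₁ hg.tmp₂ _ (moveRefs_valid ht hk)).congr ?_
  simp [moveRefs, SimVar.move, MaxCmd.map, lin, VRef.value_const, VRef.value_cell,
    VRef.value_next, SimVar.code, hg.width, hg.height, hg.addr, hk', htgt]

/-- Inside the loop `n` counts down and `cnt` counts up, so `htgt` must tolerate changes of both
registers. The indicator position `n` is written after the loop, when register `n` has been
restored. -/
theorem writes_emitMoves {n L : ℕ} {g : Reg → ℕ} {p : Fin L} (hg : RegsAt g n L p)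
    (hn : g .n = n) (hcnt : g .cnt = 0) {tgt : Reg → VRef} (ht : ∀ k ≠ .tmp₁, (tgt k).Valid)
    {t : Fin (L + 1)}
    (htgt : ∀ (g' : Reg → ℕ) (k : Reg) (k' : Fin (n + 1)),
      (∀ r, r ≠ .n → r ≠ .cnt → g' r = g r) → g' k = k' →
      (tgt k).value g' = (cell (n := n) t k').code) :
    (emitMoves tgt).Writes g ((SimVar.moves (n := n) p t).flatMap fun m =>
      (m.map SimVar.code).word ((L + 1) * (n + 1))) := by
  have hloop := Writes.loop (r := Reg.n) (i := .cnt) (by decide) hcnt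
    (p := emitCmds (moveRefs (tgt .cnt) .cnt)) (g := g)
    (fun j => if h : j < n then (SimVar.move (n := n) p t (Fin.castSucc ⟨j, h⟩)).flatMap fun m =>
      (m.map SimVar.code).word ((L + 1) * (n + 1)) else []) (fun j hj => by
        rw [dif_pos (hn ▸ hj)]
        have hr : ∀ r, r ≠ .n → r ≠ .cnt →
            Function.update (Function.update g .n (g .n - 1 - j)) .cnt j r = g r :=
          fun r h1 h2 => by simp [h1, h2]
        exact writes_moveRefs ⟨by simp [hg.width], by simp [hg.height], by simp [hg.addr],
          by simp [hg.tmp₁], by simp [hg.tmp₂]⟩ (ht _ (by decide)) (by decide) (by simp)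
          (htgt _ _ _ hr (by simp)))
  refine (hloop.seq (writes_moveRefs hg (ht _ (by decide)) (by decide) (k' := Fin.last n)
    (by simp [hn]) (htgt g _ _ (fun _ _ _ => rfl) (by simp [hn])))).congr ?_
  rw [SimVar.moves, List.finRange_succ_last, List.flatMap_append, List.flatMap_append, hn,
    flatMap_range_dite n fun k => (SimVar.move p t k.castSucc).flatMap fun m =>
      (m.map SimVar.code).word ((L + 1) * (n + 1)), List.flatMap_map, List.flatMap_assoc,
    List.flatMap_cons, List.flatMap_nil, List.append_nil]

/-- Read the operands of an instruction, write its simulation `q`, and reset the registers. -/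
def withOps (q : TProg Reg) : TProg Reg :=
  seq (read .op₁ .junk) (seq (read .op₂ .junk) (seq (read .op₃ .junk) (seq q
    (seq (clear .op₁) (seq (clear .op₂) (seq (clear .op₃) (clear .junk)))))))

/-- Write the simulation of an instruction. -/
def instrProg : TProg Reg :=
  branch
    (withOps (seq (emitCmds [lin (.const 2) (.const 2) (.cell .addr .n) (.const 0),
      lin (.cell .addr .op₁) (.cell .addr .op₂) (.cell .addr .op₃) (.const 0),
      lin (.const 3) (.const 0) (.const 0) (.const 0)]) (emitMoves (.next .addr))))
    (withOps (seq (emitCmds [lin (.const 2) (.const 2) (.cell .addr .n) (.const 0),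
      lin (.cell .addr .op₁) (.cell .addr .op₂) (.const 0) (.cell .addr .op₃),
      lin (.const 3) (.const 0) (.const 0) (.const 0)]) (emitMoves (.next .addr))))
    (withOps (seq (emitCmds ([lin (.const 2) (.const 2) (.cell .addr .n) (.const 0),
      ⟨.const 3, .cell .addr .op₂, .const 0, .cell .addr .op₁, .const 0, .const 0, .const 0⟩] ++
      List.replicate 10 (lin (.const 3) (.const 3) (.const 3) (.const 0))))
        (emitMoves (.cell .op₃))))

theorem eval_withOps {q : TProg Reg} {g : Reg → ℕ} {i j k : ℕ} {w : List CodeSym}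
    (h1 : g .op₁ = 0) (h2 : g .op₂ = 0) (h3 : g .op₃ = 0) (h4 : g .junk = 0)
    (hq : ∀ g' : Reg → ℕ, g' .op₁ = i → g' .op₂ = j → g' .op₃ = k →
      (∀ r, r ≠ .op₁ → r ≠ .op₂ → r ≠ .op₃ → r ≠ .junk → g' r = g r) → q.Writes g' w)
    (rest out : List CodeSym) :
    (withOps q).eval ⟨encUnary i ++ (encUnary j ++ (encUnary k ++ rest)), g, out⟩ =
      ⟨rest, g, out ++ w⟩ := by
  rw [withOps, eval_seq, eval_read (by decide), eval_seq, eval_read (by decide), eval_seq,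
    eval_read (by decide), eval_seq, hq _ (by simp [h1]) (by simp [h2]) (by simp [h3])
      (fun r e1 e2 e3 e4 => by simp [e1, e2, e3, e4])]
  simp only [eval_seq, eval_clear, TState.set]
  congr 1
  funext r
  cases r <;> simp [Function.update, h1, h2, h3, h4]

/-- The register values between instructions. -/
structure Clean (g : Reg → ℕ) (n L p : ℕ) : Prop extends RegsAt g n L p where
  n : g .n = n
  cnt : g .cnt = 0
  op₁ : g .op₁ = 0
  op₂ : g .op₂ = 0
  op₃ : g .op₃ = 0
  junk : g .junk = 0

/-- The common part of the three instruction forms. They differ only in the commands before the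
moves and in the target address, which `hcmds` and `htgt` match with the references. -/
theorem Clean.eval_withOps {n L : ℕ} {g : Reg → ℕ} {p : Fin L} (hg : Clean g n L p) {i j k : ℕ}
    {l : List (MaxCmd VRef)} (cmds : List (MaxCmd (SimVar n L))) {tgt : Reg → VRef}
    (t : Fin (L + 1)) (hl : ∀ m ∈ l, CmdValid m) (ht : ∀ k ≠ .tmp₁, (tgt k).Valid)
    (hcmds : ∀ g' : Reg → ℕ, g' .op₁ = i → g' .op₂ = j → g' .op₃ = k → g' .n = n →
      g' .addr = p → g' .width = n + 1 → l.map (MaxCmd.map (VRef.value g')) =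
        cmds.map (MaxCmd.map SimVar.code))
    (htgt : ∀ (g' : Reg → ℕ) (r : Reg) (k' : Fin (n + 1)), g' .op₃ = k → g' .addr = p →
      g' .width = n + 1 → g' r = k' → (tgt r).value g' = (cell (n := n) t k').code)
    (rest out : List CodeSym) :
    (withOps (seq (emitCmds l) (emitMoves tgt))).eval
      ⟨encUnary i ++ (encUnary j ++ (encUnary k ++ rest)), g, out⟩ =
      ⟨rest, g, out ++ (cmds ++ SimVar.moves p t).flatMap fun m : MaxCmd (SimVar n L) =>
        (m.map SimVar.code).word ((L + 1) * (n + 1))⟩ := by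
  refine TProg.eval_withOps hg.op₁ hg.op₂ hg.op₃ hg.junk (fun g' e1 e2 e3 e => ?_) _ _
  have hg' : RegsAt g' n L p := ⟨by rw [e, hg.width] <;> decide, by rw [e, hg.height] <;> decide,
    by rw [e, hg.addr] <;> decide, by rw [e, hg.tmp₁] <;> decide, by rw [e, hg.tmp₂] <;> decide⟩
  have hn : g' .n = n := by rw [e, hg.n] <;> decide
  have hc : g' .cnt = 0 := by rw [e, hg.cnt] <;> decide
  refine ((writes_emitCmds hg'.tmp₁ hg'.tmp₂ l hl).seq (writes_emitMoves hg' hn hc ht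
    (t := t) fun g'' k' r h hr => ?_)).congr ?_
  · refine htgt g'' k' r ?_ ?_ ?_ hr
    · rw [h _ (by decide) (by decide), e3]
    · rw [h _ (by decide) (by decide), hg'.addr]
    · rw [h _ (by decide) (by decide), hg'.width]
  · rw [hcmds g' e1 e2 e3 hn hg'.addr hg'.width, hg'.width, hg'.height, List.flatMap_append,
      List.flatMap_map]

theorem eval_instrProg {n L : ℕ} {g : Reg → ℕ} {p : Fin L} (hg : Clean g n L p)
    (ins : CPInstr n (L + 1)) (rest out : List CodeSym) :
    instrProg.eval ⟨ins.encode ++ rest, g, out⟩ =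
      ⟨rest, g, out ++ (SimVar.instr p ins).flatMap fun m =>
        (m.map SimVar.code).word ((L + 1) * (n + 1))⟩ := by
  cases ins with
  | add i j k =>
    rw [CPInstr.encode, List.cons_append, List.append_assoc, List.append_assoc, instrProg,
      eval_branch_add, SimVar.instr]
    refine hg.eval_withOps _ _ ?_ ?_ (fun g' e1 e2 e3 hn ha hw => ?_)
      (fun g' r k' e3 ha hw hr => ?_) _ _
    · simp [CmdValid, lin, VRef.valid_const, VRef.valid_cell]
    · simp [VRef.valid_next]
    · simp [MaxCmd.map, lin, VRef.value_const, VRef.value_cell, SimVar.code, e1, e2, e3, ha, hw, hn]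
    · simp [VRef.value_next, SimVar.code, ha, hw, hr]
  | sub i j k =>
    rw [CPInstr.encode, List.cons_append, List.append_assoc, List.append_assoc, instrProg,
      eval_branch_sub, SimVar.instr]
    refine hg.eval_withOps _ _ ?_ ?_ (fun g' e1 e2 e3 hn ha hw => ?_)
      (fun g' r k' e3 ha hw hr => ?_) _ _
    · simp [CmdValid, lin, VRef.valid_const, VRef.valid_cell]
    · simp [VRef.valid_next]
    · simp [MaxCmd.map, lin, VRef.value_const, VRef.value_cell, SimVar.code, e1, e2, e3, ha, hw, hn]
    · simp [VRef.value_next, SimVar.code, ha, hw, hr]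
  | test i j t =>
    rw [CPInstr.encode, List.cons_append, List.append_assoc, List.append_assoc, instrProg,
      eval_branch_test, SimVar.instr]
    refine hg.eval_withOps _ _ ?_ ?_ (fun g' e1 e2 e3 hn ha hw => ?_)
      (fun g' r k' e3 ha hw hr => ?_) _ _
    · simp [CmdValid, lin, VRef.valid_const, VRef.valid_cell]
    · simp [VRef.valid_cell]
    · simp [MaxCmd.map, lin, VRef.value_const, VRef.value_cell, SimVar.code, e1, e2, ha, hw, hn]
    · simp [VRef.value_cell, SimVar.code, e3, hw, hr]

/-- The program of the reduction. -/
def reduction : TProg Reg :=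
  seq (read .n .width) (seq (read .len .height)
    (seq (rep₂ .height .tmp₁ .width .tmp₂ .tick)
    (seq (emit (encUnary 6 ++ [.sep, .bit true, .sep, .bit true, .sep, .sep, .sep, .sep]))
    (seq (loop .n .cnt copy)
    (seq (emit [.bit true, .sep]) (seq (rep₂ .len .tmp₁ .width .tmp₂ .sep)
    (seq (emitCmds [lin (.const 2) (.const 2) (.const 0) (.const 1)])
    (seq (loop .len .addr instrProg) (seq (emit [.sep]) (seq copy
    (seq (VRef.cell .len .n).emit (seq (emit (encUnary 2))
    (seq (clear .n) (seq (clear .width) (seq (clear .len) (clear .height))))))))))))))))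

theorem reduction_WF : reduction.WF := by
  simp [reduction, WF, Uses, rep₂, rep, emitCmds, emitCmd, emitTerm, VRef.emit, instrProg, withOps,
    emitMoves, moveRefs, lin]

theorem eval_reduction (I : TerminationInstance) :
    reduction.eval ⟨I.encode, fun _ => 0, []⟩ = ⟨[], fun _ => 0, I.toPowering.encode⟩ := by
  obtain ⟨⟨n, L, prog, init⟩, N⟩ := I
  rw [TerminationInstance.encode_toPowering]
  simp only [TerminationInstance.encode]
  rw [reduction, eval_seq, eval_read (by decide), eval_seq, eval_read (by decide)]
  set g := Function.update (Function.update _ Reg.len _) Reg.height _ with hgdef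
  have hn : g .n = n := by simp [hgdef]
  have hw : g .width = n + 1 := by simp [hgdef]
  have hL : g .len = L := by simp [hgdef]
  have hh : g .height = L + 1 := by simp [hgdef]
  have h0 : ∀ r, r ≠ .n → r ≠ .width → r ≠ .len → r ≠ .height → g r = 0 := by
    intro r h1 h2 h3 h4
    simp [hgdef, h1, h2, h3, h4]
  -- From here on only the listed register values matter, not how they arose.
  clear_value g
  have h1 : g .tmp₁ = 0 := h0 _ (by decide) (by decide) (by decide) (by decide)
  have h2 : g .tmp₂ = 0 := h0 _ (by decide) (by decide) (by decide) (by decide)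
  have hloop₁ := fun rest out => eval_loop (r := Reg.n) (i := .cnt) (by decide) (p := copy)
    (g := g) (h0 _ (by decide) (by decide) (by decide) (by decide))
    (fun j => ((List.ofFn fun i => encBinary (init i)).drop j).flatten ++ rest)
    (fun j => if h : j < n then encBinary (init ⟨j, h⟩) else []) (fun j hj out => by
      rw [hn] at hj
      simp only [flatten_drop_ofFn _ hj, List.append_assoc, dif_pos hj]
      exact eval_copy _ _ _ _) out
  -- The counter of this loop is the current address. Since `len` counts down meanwhile, the body
  -- takes the size of the program from `height`.
  have hloop₂ := fun rest out => eval_loop (r := Reg.len) (i := .addr) (by decide)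
    (p := instrProg) (g := g) (h0 _ (by decide) (by decide) (by decide) (by decide))
    (fun j => ((List.ofFn fun i => (prog i).encode).drop j).flatten ++ rest)
    (fun j => if h : j < L then (SimVar.instr ⟨j, h⟩ (prog ⟨j, h⟩)).flatMap fun m =>
        (m.map SimVar.code).word ((L + 1) * (n + 1)) else []) (fun j hj out => by
      rw [hL] at hj
      simp only [flatten_drop_ofFn _ hj, List.append_assoc, dif_pos hj]
      refine eval_instrProg ⟨⟨?_, ?_, ?_, ?_, ?_⟩, ?_, ?_, ?_, ?_, ?_, ?_⟩ _ _ _ <;>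
        simp [hw, hh, h1, h2, hn, h0]) out
  rw [hn] at hloop₁
  rw [hL] at hloop₂
  simp only [List.drop_zero] at hloop₁ hloop₂
  simp only [flatMap_range_dite n fun i => encBinary (init i)] at hloop₁
  simp only [flatMap_range_dite L fun p => (SimVar.instr p (prog p)).flatMap fun m =>
    (m.map SimVar.code).word ((L + 1) * (n + 1))] at hloop₂
  rw [List.drop_of_length_le (by simp), List.flatten_nil] at hloop₁ hloop₂
  -- The numbers 2, 0 and 1 stand for `excess`, `zero` and `one` in the command that opens a pass.
  have hpass : ((SimVar.pass ⟨n, L, prog, init⟩).flatMap fun m : MaxCmd (SimVar n L) =>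
      (m.map SimVar.code).word ((L + 1) * (n + 1))) = (lin 2 2 0 1).word ((L + 1) * (n + 1)) ++
      (List.finRange L).flatMap fun p => (SimVar.instr p (prog p)).flatMap fun m =>
        (m.map SimVar.code).word ((L + 1) * (n + 1)) := by
    rw [SimVar.pass, List.flatMap_cons, List.flatMap_assoc]
    rfl
  rw [hpass]
  generalize ((List.finRange L).flatMap fun p => (SimVar.instr p (prog p)).flatMap fun m =>
    (m.map SimVar.code).word ((L + 1) * (n + 1))) = W at hloop₂ ⊢
  have hcopy := fun out => eval_copy (R := Reg) N [] g out
  rw [List.append_nil] at hcopy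
  rw [eval_seq, writes_rep₂ (by decide) (by decide) (by decide) (by decide) (by decide) (by decide)
      h1 h2, eval_seq, writes_emit, encTuple, eval_seq, hloop₁, List.nil_append, eval_seq,
    writes_emit, eval_seq, writes_rep₂ (by decide) (by decide) (by decide) (by decide) (by decide)
      (by decide) h1 h2, eval_seq, writes_emitCmds h1 h2 _ (by
        simp [CmdValid, lin, VRef.valid_const]), encTuple, eval_seq, hloop₂, List.nil_append,
    eval_seq, writes_emit, eval_seq, hcopy, eval_seq,
    VRef.writes_emit _ (by simp [VRef.valid_cell]) h1 h2, eval_seq, writes_emit]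
  simp only [eval_seq, eval_clear, TState.set]
  congr 1
  · funext r
    cases r <;> simp [Function.update, h0]
  · simp [MaxCmd.map, lin, VRef.value_const, VRef.value_cell, hn, hw, hL, hh, VRef.encUnary_add,
      List.ofFn_eq_map, List.flatMap_def]

end TProg

theorem mainTheorem4 :
    ∃ f : TerminationInstance → PoweringInstance,
      Nonempty (Turing.TM2ComputableInPolyTime
        TerminationInstance.encode PoweringInstance.encode f) ∧
      ∀ I : TerminationInstance, I.program.IsSimple →
        (I.program.HaltsWithin I.bound ↔ (f I).IsPositive) :=
  ⟨TerminationInstance.toPowering,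
    TProg.reduction.polyTime TProg.reduction_WF _ _ _ TProg.eval_reduction,
    TerminationInstance.isPositive_toPowering⟩
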